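/- **Setting.** Let $n\ge 1$ agents minimize $f(x)=\frac1n\sum_{i=1}^n f_i(x)$ over $x\in\mathbb R^d$, where $f_i(x)=\mathbb E_{\xi_i}[F_i(x;\xi_i)]$, each $f_i$ is continuously differentiable with $L$-Lipschitz gradient ($L>0$), and $f$ is bounded below with $f^*=\inf f$. Let $W^{(0)},\dots,W^{(\tau-1)}\in\mathbb R^{n\times n}$ ($\tau\ge1$) be doubly stochastic with $W^{(\tau-1)}\cdots W^{(1)}W^{(0)}=\frac1n\mathbf 1\mathbf 1^{\mathsf T}$ (finite-time consensus). Write $\mathbf x=(x_1,\dots,x_n)$, $\bar x=\frac1n\sum_i x_i$, $\bar{\mathbf x}=(\bar x,\dots,\bar x)$, $\nabla\mathbf F(\mathbf x;\boldsymbol\xi)=(\nabla F_i(x_i;\xi_i))_{i}$, $\overline{\nabla f}(\mathbf x)=\frac1n\sum_i\nabla f_i(x_i)$, and let an $n\times n$ matrix act on $(\mathbb R^d)^n$ blockwise. GT-FT with step size $\alpha$ is: $\mathbf g^{(0)}=\nabla\mathbf F(\mathbf x^{(0)};\boldsymbol\xi^{(0)})$ and, for $k\ge0$, $$\mathbf x^{(k+1)}=W^{(k\bmod\tau)}(\mathbf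 x^{(k)}-\alpha\mathbf g^{(k)}),\qquad \mathbf g^{(k+1)}=W^{(k\bmod\tau)}\mathbf g^{(k)}+\nabla\mathbf F(\mathbf x^{(k+1)};\boldsymbol\xi^{(k+1)})-\nabla\mathbf F(\mathbf x^{(k)};\boldsymbol\xi^{(k)}).$$ A *warm-up strategy* may replace the communication of the first period: for $k<\tau$ the matrix $W^{(k\bmod\tau)}$ may be replaced by any doubly stochastic $V^{(k)}$, and for $k\le\tau$ the newly computed $\mathbf g^{(k)}$ may be multiplied by any doubly stochastic $U^{(k)}$ (AllReduce is $V^{(k)}=\frac1n\mathbf 1\mathbf 1^{\mathsf T}$, respectively $U^{(k)}=\frac1n\mathbf 1\mathbf 1^{\mathsf T}$; no warm-up is $V^{(k)}=W^{(k)}$, $U^{(k)}=I$). The samples $\xi_i^{(k)}$ ($k\in\mathbb N$, $1\le i\le n$) are independent of each other and of $\mathbf x^{(0)}$, and with $\mathcal F^{(k)}=\sigma(\mathbf x^{(0)},\dots,\mathbf x^{(k)})$ and some $\sigma>0$, for all $k$ and $i$, $$\mathbb E[\nabla F_i(x_i^{(k)};\xi_i^{(k)})-\nabla f_i(x_i^{(k)})\mid\mathcal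 F^{(k)}]=0,\qquad \mathbb E[\|\nabla F_i(x_i^{(k)};\xi_i^{(k)})-\nabla f_i(x_i^{(k)})\|^2\mid\mathcal F^{(k)}]\le\sigma^2 .$$ **Corollary.** For every $\Delta$ there are constants $\gamma_7,\gamma_8,\gamma_9>0$, depending only on $\Delta$, such that the following holds for all $n,d,\tau,L,\sigma$, all data as above with $\mathbb E[f(\bar x^{(0)})-f^*]\le\Delta$, and all integers $T\ge\tau$. Let $$\alpha=\min\Big\{\big(\tfrac{c_0}{c_1T}\big)^{1/2},\big(\tfrac{c_0}{c_2T}\big)^{1/3},\tfrac1{2L},\tfrac1{4\sqrt3\,\tau^2L}\Big\},\qquad c_0=1,\quad c_1=\tfrac{L\sigma^2}{n},\quad c_2=\tau^3L^2\sigma^2,$$ and suppose that the warm-up strategy ensures $\sum_{k=0}^{\tau}\mathbb E\|\mathbf x^{(k)}-\bar{\mathbf x}^{(k)}\|^2=0$. Then the iterates of GT-FT with this warm-up satisfy $$\frac1{T+1}\sum_{k=0}^{T}\Big(\mathbb E\|\overline{\nabla f}(\mathbf x^{(k)})\|^2+\mathbb E\|\nabla f(\bar x^{(k)})\|^2\Big)\le\frac{\gamma_7\tau^2L}{T}+\gamma_8\,\tau\Big(\frac{L\sigma}{T}\Big)^{2/3}+\gamma_9\Big(\frac{L\sigma^2}{nT}\Big)^{1/2}.$$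 -/

import Mathlib

open MeasureTheory ProbabilityTheory
open scoped ENNReal

namespace GTFT

/-- The parameter space `ℝ^d` with its Euclidean norm. -/
abbrev Vec (d : ℕ) : Type := EuclideanSpace ℝ (Fin d)

/-- The average `(1/n) ∑ i, v i` of the vectors held by the `n` agents. -/
noncomputable def avg {n d : ℕ} (v : Fin n → Vec d) : Vec d :=
  (n : ℝ)⁻¹ • ∑ i, v i

/-- The action of `A ⊗ I_d` on stacked vectors: agent `i` receives `∑ j, A i j • v j`. -/
noncomputable def mix {n d : ℕ} (A : Matrix (Fin n) (Fin n) ℝ) (v : Fin n → Vec d) :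
    Fin n → Vec d :=
  fun i => ∑ j, A i j • v j

/-! ### Finite-time consensus -/

/-- The product `W (m - 1) * ⋯ * W 1 * W 0`. -/
def sweep {n : ℕ} (W : ℕ → Matrix (Fin n) (Fin n) ℝ) : ℕ → Matrix (Fin n) (Fin n) ℝ
  | 0 => 1
  | m + 1 => W m * sweep W m

/-- `W 0, …, W (τ - 1)` are doubly stochastic and
`W (τ - 1) * ⋯ * W 1 * W 0 = (1/n) 𝟙 𝟙ᵀ`.  The matrices `W l` with `τ ≤ l` play no role. -/
structure FiniteTimeConsensus {n : ℕ} (τ : ℕ) (W : ℕ → Matrix (Fin n) (Fin n) ℝ) : Prop where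
  one_le : 1 ≤ τ
  doublyStochastic : ∀ l < τ, W l ∈ doublyStochastic ℝ (Fin n)
  sweep_eq : sweep W τ = Matrix.of fun _ _ => (n : ℝ)⁻¹

/-! ### The optimization problem -/

/-- The local objective `f_i x = 𝔼 [F_i (x; ξ_i)]`, where `ξ_i` has law `P i`. -/
noncomputable def localObj {n d : ℕ} {Ξ : Fin n → Type*} [∀ i, MeasurableSpace (Ξ i)]
    (P : ∀ i, Measure (Ξ i)) (F : ∀ i, Vec d → Ξ i → ℝ) (i : Fin n) (x : Vec d) : ℝ :=
  ∫ ζ, F i x ζ ∂(P i)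

/-- The global objective `f x = (1/n) ∑ i, f_i x`. -/
noncomputable def obj {n d : ℕ} {Ξ : Fin n → Type*} [∀ i, MeasurableSpace (Ξ i)]
    (P : ∀ i, Measure (Ξ i)) (F : ∀ i, Vec d → Ξ i → ℝ) (x : Vec d) : ℝ :=
  (n : ℝ)⁻¹ * ∑ i, localObj P F i x

/-- Stacked true gradients: `∇ f_i (x_i)` for each agent `i`. -/
noncomputable def trueGrad {n d : ℕ} {Ξ : Fin n → Type*} [∀ i, MeasurableSpace (Ξ i)]
    (P : ∀ i, Measure (Ξ i)) (F : ∀ i, Vec d → Ξ i → ℝ) (x : Fin n → Vec d) : Fin n → Vec d :=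
  fun i => gradient (localObj P F i) (x i)

/-- Stacked stochastic gradients: `∇ F_i (x_i; ζ_i)` (gradient in the first variable). -/
noncomputable def stochGrad {n d : ℕ} {Ξ : Fin n → Type*}
    (F : ∀ i, Vec d → Ξ i → ℝ) (x : Fin n → Vec d) (ζ : ∀ i, Ξ i) : Fin n → Vec d :=
  fun i => gradient (fun y => F i y (ζ i)) (x i)

/-- The regularity that is implicit in writing `𝔼 [F_i (x; ξ_i)]` and `∇ F_i (x; ξ_i)`. -/
structure LossRegular {n d : ℕ} {Ξ : Fin n → Type*} [∀ i, MeasurableSpace (Ξ i)]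
    (P : ∀ i, Measure (Ξ i)) (F : ∀ i, Vec d → Ξ i → ℝ) : Prop where
  measurable : ∀ i, Measurable fun p : Vec d × Ξ i => F i p.1 p.2
  differentiable : ∀ i (ζ : Ξ i), Differentiable ℝ fun x => F i x ζ
  integrable : ∀ i x, Integrable (F i x) (P i)

/-- Every `f_i` is continuously differentiable with `L`-Lipschitz gradient, and `f` is bounded
below. -/
structure SmoothProblem {n d : ℕ} {Ξ : Fin n → Type*} [∀ i, MeasurableSpace (Ξ i)]
    (P : ∀ i, Measure (Ξ i)) (F : ∀ i, Vec d → Ξ i → ℝ) (L : ℝ) : Prop where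
  pos : 0 < L
  contDiff : ∀ i, ContDiff ℝ 1 (localObj P F i)
  lipschitz : ∀ i x y,
    ‖gradient (localObj P F i) x - gradient (localObj P F i) y‖ ≤ L * ‖x - y‖
  bddBelow : BddBelow (Set.range (obj P F))

/-- The optimal value `f* = inf f`. -/
noncomputable def optVal {n d : ℕ} {Ξ : Fin n → Type*} [∀ i, MeasurableSpace (Ξ i)]
    (P : ∀ i, Measure (Ξ i)) (F : ∀ i, Vec d → Ξ i → ℝ) : ℝ :=
  ⨅ x, obj P F x

/-! ### The algorithm -/

/-- One sample path of gradient tracking: the pair `(x^(k), g^(k))` of stacked parameters and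
tracking variables, with mixing matrices `A k`, and with an additional averaging `B k` of the
tracking variables after they have been computed (`B k = 1` means no additional averaging):

* `g^(0) = B 0 (∇F(x^(0); ξ^(0)))`,
* `x^(k+1) = A k (x^(k) - α g^(k))`,
* `g^(k+1) = B (k+1) (A k g^(k) + ∇F(x^(k+1); ξ^(k+1)) - ∇F(x^(k); ξ^(k)))`. -/
noncomputable def gradTracking {n d : ℕ} {Ξ : Fin n → Type*} (F : ∀ i, Vec d → Ξ i → ℝ)
    (A B : ℕ → Matrix (Fin n) (Fin n) ℝ) (α : ℝ) (x₀ : Fin n → Vec d) (ζ : ℕ → ∀ i, Ξ i) :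
    ℕ → (Fin n → Vec d) × (Fin n → Vec d)
  | 0 => (x₀, mix (B 0) (stochGrad F x₀ (ζ 0)))
  | k + 1 =>
    let p := gradTracking F A B α x₀ ζ k
    let x := mix (A k) (p.1 - α • p.2)
    (x, mix (B (k + 1))
      (mix (A k) p.2 + stochGrad F x (ζ (k + 1)) - stochGrad F p.1 (ζ k)))

/-- Mixing matrix of iteration `k`: the warm-up matrix `V k` in the first period `k < τ`, and
`W (k mod τ)` afterwards. -/
def mixSchedule {n : ℕ} (τ : ℕ) (V W : ℕ → Matrix (Fin n) (Fin n) ℝ) (k : ℕ) :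
    Matrix (Fin n) (Fin n) ℝ :=
  if k < τ then V k else W (k % τ)

/-- Additional averaging of the tracking variable `g^(k)`: the warm-up matrix `U k` for `k ≤ τ`,
and none afterwards. -/
def trackSchedule {n : ℕ} (τ : ℕ) (U : ℕ → Matrix (Fin n) (Fin n) ℝ) (k : ℕ) :
    Matrix (Fin n) (Fin n) ℝ :=
  if k ≤ τ then U k else 1

/-- The iterates `x^(k)` of GT-FT (gradient tracking which cycles through `W 0, …, W (τ - 1)`)
whose communication in the first period is governed by a warm-up strategy `V, U`.

* `V k = W k` and `U k = 1`: plain GT-FT, without any warm-up.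
* `V k = (1/n) 𝟙 𝟙ᵀ`: AllReduce of the parameters, for `k < τ`.
* `U k = (1/n) 𝟙 𝟙ᵀ`: AllReduce of the tracking variables, for `k ≤ τ`. -/
noncomputable def iterates {n d : ℕ} {Ξ : Fin n → Type*} {Ω : Type*} (F : ∀ i, Vec d → Ξ i → ℝ)
    (τ : ℕ) (W V U : ℕ → Matrix (Fin n) (Fin n) ℝ) (α : ℝ) (x₀ : Ω → Fin n → Vec d)
    (ξ : ℕ → ∀ i, Ω → Ξ i) (k : ℕ) (ω : Ω) : Fin n → Vec d :=
  (gradTracking F (mixSchedule τ V W) (trackSchedule τ U) α (x₀ ω) (fun j i => ξ j i ω) k).1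

/-- The `σ`-algebra `ℱ^(k)` generated by the initial condition `x 0` and by `x 1, …, x k`. -/
@[reducible] def history {n d : ℕ} {Ω : Type*} (x : ℕ → Ω → Fin n → Vec d) (k : ℕ) : MeasurableSpace Ω :=
  ⨆ j ∈ Finset.range (k + 1), MeasurableSpace.comap (x j) inferInstance

/-- Gradient noise `∇F_i (x_i^(k); ξ_i^(k)) - ∇f_i (x_i^(k))` of agent `i` at iteration `k`. -/
noncomputable def noise {n d : ℕ} {Ξ : Fin n → Type*} [∀ i, MeasurableSpace (Ξ i)] {Ω : Type*}
    (P : ∀ i, Measure (Ξ i)) (F : ∀ i, Vec d → Ξ i → ℝ) (x : ℕ → Ω → Fin n → Vec d)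
    (ξ : ℕ → ∀ i, Ω → Ξ i) (k : ℕ) (i : Fin n) (ω : Ω) : Vec d :=
  stochGrad F (x k ω) (fun i => ξ k i ω) i - trueGrad P F (x k ω) i

/-- The sampling assumption along the iterates `x`: the samples `ξ k i` are independent of each
other and of the initial condition, and given `ℱ^(k)` the stochastic gradients are unbiased with
variance at most `σ²`. -/
structure NoiseAssumption {n d : ℕ} {Ξ : Fin n → Type*} [∀ i, MeasurableSpace (Ξ i)]
    {Ω : Type*} [MeasurableSpace Ω] (μ : Measure Ω)
    (P : ∀ i, Measure (Ξ i)) (F : ∀ i, Vec d → Ξ i → ℝ) (x : ℕ → Ω → Fin n → Vec d)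
    (ξ : ℕ → ∀ i, Ω → Ξ i) (σ : ℝ) : Prop where
  pos : 0 < σ
  measurable_init : Measurable (x 0)
  measurable_sample : ∀ k i, Measurable (ξ k i)
  indep : iIndepFun (fun p : ℕ × Fin n => ξ p.1 p.2) μ
  indep_init : IndepFun (x 0) (fun ω (p : ℕ × Fin n) => ξ p.1 p.2 ω) μ
  memLp : ∀ k i, MemLp (noise P F x ξ k i) 2 μ
  unbiased : ∀ k i, μ[noise P F x ξ k i | history x k] =ᵐ[μ] 0
  variance : ∀ k i, μ[fun ω => ‖noise P F x ξ k i ω‖ ^ 2 | history x k] ≤ᵐ[μ] fun _ => σ ^ 2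

/-- The expected squared norm `𝔼 ‖X‖²`, as an extended nonnegative number. -/
noncomputable def meanSq {Ω : Type*} [MeasurableSpace Ω] {d : ℕ} (μ : Measure Ω)
    (X : Ω → Vec d) : ℝ≥0∞ :=
  ∫⁻ ω, ‖X ω‖ₑ ^ 2 ∂μ

/-- The consensus error `𝔼 ‖x - x̄‖² = ∑ i, 𝔼 ‖x_i - x̄‖²`. -/
noncomputable def consensusError {Ω : Type*} [MeasurableSpace Ω] {n d : ℕ} (μ : Measure Ω)
    (x : Ω → Fin n → Vec d) : ℝ≥0∞ :=
  ∑ i, meanSq μ fun ω => x ω i - avg (x ω)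

/-- The step size
`min {(c₀/(c₁ T))^(1/2), (c₀/(c₂ T))^(1/3), 1/(2L), 1/(4√3 τ² L)}` with
`c₀ = 1`, `c₁ = L σ² / n`, `c₂ = τ³ L² σ²`. -/
noncomputable def stepSize (n τ T : ℕ) (L σ : ℝ) : ℝ :=
  let c₀ : ℝ := 1
  let c₁ : ℝ := L * σ ^ 2 / n
  let c₂ : ℝ := (τ : ℝ) ^ 3 * L ^ 2 * σ ^ 2
  min (min ((c₀ / (c₁ * T)) ^ (1 / 2 : ℝ)) ((c₀ / (c₂ * T)) ^ (1 / 3 : ℝ)))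
    (min (1 / (2 * L)) (1 / (4 * Real.sqrt 3 * (τ : ℝ) ^ 2 * L)))

end GTFT

/-!
Communication preserves averages, so the average iterate performs a perturbed gradient descent on
`f`, whose perturbations are the averaged noise and the deviations of the agents from consensus.
A full sweep of the mixing matrices annihilates deviations. As the agents agree throughout the
warm-up period, the deviations are therefore driven only by the increments of the stochastic
gradients over the last two periods. By Lipschitz continuity the exact part of an increment is
controlled by the displacement of the iterates, that is, by the deviations again and by the averaged
gradients, and a small step size absorbs this feedback. The noises of distinct agents and iterations
are orthogonal in `L²`, hence their squared norms add up, which produces the factor `τ³` in the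
deviations and `1 / n` in the average. Telescoping the descent inequality for `f` along the average
iterate and inserting the step size gives the rate.
-/

namespace GTFT

/-! ### Stacked vectors -/

section Jensen

variable {E : Type*} [SeminormedAddCommGroup E]

lemma norm_add_sq_le_two_mul (u v : E) : ‖u + v‖ ^ 2 ≤ 2 * (‖u‖ ^ 2 + ‖v‖ ^ 2) :=
  (pow_le_pow_left₀ (norm_nonneg _) (norm_add_le u v) 2).trans add_sq_le

lemma norm_sum_smul_sq_le [NormedSpace ℝ E] {ι : Type*} {s : Finset ι} {w : ι → ℝ}
    (hw : ∀ i ∈ s, 0 ≤ w i) (y : ι → E) :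
    ‖∑ i ∈ s, w i • y i‖ ^ 2 ≤ (∑ i ∈ s, w i) * ∑ i ∈ s, w i * ‖y i‖ ^ 2 := by
  have triangle : ‖∑ i ∈ s, w i • y i‖ ≤ ∑ i ∈ s, w i * ‖y i‖ := by
    refine (norm_sum_le _ _).trans (Finset.sum_le_sum fun i hi => ?_)
    rw [norm_smul, Real.norm_of_nonneg (hw i hi)]
  refine (pow_le_pow_left₀ (norm_nonneg _) triangle 2).trans ?_
  exact Finset.sum_sq_le_sum_mul_sum_of_sq_le_mul s hw
    (fun i hi => mul_nonneg (hw i hi) (sq_nonneg _)) fun i _ => le_of_eq (by ring)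

end Jensen

section StackedVectors

variable {n d : ℕ}

/-- The squared Euclidean norm `‖v‖² = ∑ i, ‖v i‖²` of a stacked vector, as opposed to the
supremum norm that `Fin n → Vec d` carries. -/
noncomputable def sqNorm (v : Fin n → Vec d) : ℝ := ∑ i, ‖v i‖ ^ 2

/-- The deviation `v - v̄` of a stacked vector from its average. -/
noncomputable def deviation (v : Fin n → Vec d) : Fin n → Vec d := fun i => v i - avg v

lemma sqNorm_nonneg (v : Fin n → Vec d) : 0 ≤ sqNorm v :=
  Finset.sum_nonneg fun _ _ => sq_nonneg _

lemma sqNorm_smul (c : ℝ) (v : Fin n → Vec d) : sqNorm (c • v) = c ^ 2 * sqNorm v := by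
  simp [sqNorm, norm_smul, mul_pow, Finset.mul_sum]

lemma sqNorm_add_le (u v : Fin n → Vec d) : sqNorm (u + v) ≤ 2 * (sqNorm u + sqNorm v) := by
  simp only [sqNorm, ← Finset.sum_add_distrib, Finset.mul_sum]
  exact Finset.sum_le_sum fun i _ => norm_add_sq_le_two_mul _ _

lemma sqNorm_sub_le (u v : Fin n → Vec d) : sqNorm (u - v) ≤ 2 * (sqNorm u + sqNorm v) := by
  simpa [sub_eq_add_neg, sqNorm] using sqNorm_add_le u (-v)

lemma sqNorm_sum_smul_le {ι : Type*} {s : Finset ι} {w : ι → ℝ} (hw : ∀ i ∈ s, 0 ≤ w i)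
    (y : ι → Fin n → Vec d) :
    sqNorm (∑ i ∈ s, w i • y i) ≤ (∑ i ∈ s, w i) * ∑ i ∈ s, w i * sqNorm (y i) := by
  calc sqNorm (∑ i ∈ s, w i • y i)
      ≤ ∑ a, (∑ i ∈ s, w i) * ∑ i ∈ s, w i * ‖y i a‖ ^ 2 :=
        Finset.sum_le_sum fun a _ => by
          simpa [Finset.sum_apply] using norm_sum_smul_sq_le hw fun i => y i a
    _ = (∑ i ∈ s, w i) * ∑ i ∈ s, w i * sqNorm (y i) := by
        simp only [sqNorm, Finset.mul_sum]
        exact Finset.sum_comm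

lemma isLinearMap_avg : IsLinearMap ℝ (avg : (Fin n → Vec d) → Vec d) where
  map_add u v := by simp [avg, Finset.sum_add_distrib]
  map_smul c v := by simp [avg, ← Finset.smul_sum, smul_comm c]

lemma isLinearMap_deviation :
    IsLinearMap ℝ (deviation : (Fin n → Vec d) → Fin n → Vec d) where
  map_add u v := by ext1 i; simp only [deviation, isLinearMap_avg.map_add, Pi.add_apply]; abel
  map_smul c v := by
    ext1 i; simp only [deviation, isLinearMap_avg.map_smul, Pi.smul_apply, smul_sub]

lemma isLinearMap_mix (A : Matrix (Fin n) (Fin n) ℝ) :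
    IsLinearMap ℝ (mix A : (Fin n → Vec d) → Fin n → Vec d) where
  map_add u v := by ext1 i; simp [mix, Finset.sum_add_distrib]
  map_smul c v := by ext1 i; simp [mix, Finset.smul_sum, smul_comm c]

lemma deviation_sum_smul {ι : Type*} (s : Finset ι) (c : ι → ℝ) (v : ι → Fin n → Vec d) :
    deviation (∑ i ∈ s, c i • v i) = ∑ i ∈ s, c i • deviation (v i) := by
  simpa only [IsLinearMap.mk'_apply, isLinearMap_deviation.map_smul] using
    map_sum (isLinearMap_deviation.mk' deviation) (fun i => c i • v i) s

lemma mix_sum {ι : Type*} (A : Matrix (Fin n) (Fin n) ℝ) (s : Finset ι)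
    (v : ι → Fin n → Vec d) : mix A (∑ i ∈ s, v i) = ∑ i ∈ s, mix A (v i) :=
  map_sum ((isLinearMap_mix A).mk' _) v s

lemma sum_eq_smul_avg (v : Fin n → Vec d) : ∑ i, v i = (n : ℝ) • avg v := by
  rcases n.eq_zero_or_pos with rfl | hn
  · simp
  · simp [avg, smul_smul, hn.ne']

lemma avg_deviation (v : Fin n → Vec d) : avg (deviation v) = 0 := by
  have : ∑ i, deviation v i = 0 := by
    simp [deviation, Finset.sum_sub_distrib, ← Nat.cast_smul_eq_nsmul ℝ, sum_eq_smul_avg]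
  rw [avg, this, smul_zero]

lemma sqNorm_eq_deviation_add (v : Fin n → Vec d) :
    sqNorm v = sqNorm (deviation v) + n * ‖avg v‖ ^ 2 := by
  have pythagoras (i : Fin n) : ‖v i‖ ^ 2
      = ‖deviation v i‖ ^ 2 + 2 * inner ℝ (deviation v i) (avg v) + ‖avg v‖ ^ 2 := by
    rw [← norm_add_sq_real, deviation, sub_add_cancel]
  simp only [sqNorm, pythagoras, Finset.sum_add_distrib, ← Finset.mul_sum, ← sum_inner]
  simp [sum_eq_smul_avg, avg_deviation]

lemma sqNorm_deviation_le (v : Fin n → Vec d) : sqNorm (deviation v) ≤ sqNorm v := by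
  rw [sqNorm_eq_deviation_add v]
  exact le_add_of_nonneg_right (by positivity)

lemma norm_avg_sq_le (v : Fin n → Vec d) : ‖avg v‖ ^ 2 ≤ (n : ℝ)⁻¹ * sqNorm v := by
  rcases n.eq_zero_or_pos with rfl | hn
  · simp [avg]
  · rw [le_inv_mul_iff₀ (by positivity), sqNorm_eq_deviation_add v]
    exact le_add_of_nonneg_left (sqNorm_nonneg _)

end StackedVectors

/-! ### Finite-time consensus -/

section Mixing

variable {n d : ℕ} {A : Matrix (Fin n) (Fin n) ℝ}

lemma mix_one (v : Fin n → Vec d) : mix 1 v = v := by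
  ext1 i; simp [mix, Matrix.one_apply, ite_smul]

lemma mix_mul (A B : Matrix (Fin n) (Fin n) ℝ) (v : Fin n → Vec d) :
    mix (A * B) v = mix A (mix B v) := by
  ext1 i
  simp only [mix, Matrix.mul_apply, Finset.sum_smul, Finset.smul_sum, smul_smul]
  exact Finset.sum_comm

lemma mix_averaging (v : Fin n → Vec d) :
    mix (Matrix.of fun _ _ => (n : ℝ)⁻¹) v = fun _ => avg v :=
  funext fun _ => by simp [mix, avg, Finset.smul_sum]

lemma avg_mix (hA : A ∈ doublyStochastic ℝ (Fin n)) (v : Fin n → Vec d) :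
    avg (mix A v) = avg v := by
  simp only [avg, mix]
  rw [Finset.sum_comm]
  simp [← Finset.sum_smul, sum_col_of_mem_doublyStochastic hA]

lemma deviation_mix (hA : A ∈ doublyStochastic ℝ (Fin n)) (v : Fin n → Vec d) :
    deviation (mix A v) = mix A (deviation v) := by
  ext1 i
  simp [deviation, avg_mix hA, mix, smul_sub, Finset.sum_sub_distrib, ← Finset.sum_smul,
    sum_row_of_mem_doublyStochastic hA]

lemma sqNorm_mix_le (hA : A ∈ doublyStochastic ℝ (Fin n)) (v : Fin n → Vec d) :
    sqNorm (mix A v) ≤ sqNorm v := by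
  have jensen (i : Fin n) : ‖mix A v i‖ ^ 2 ≤ ∑ j, A i j * ‖v j‖ ^ 2 := by
    simpa [mix, sum_row_of_mem_doublyStochastic hA] using
      norm_sum_smul_sq_le (s := Finset.univ) (w := A i)
        (fun j _ => nonneg_of_mem_doublyStochastic hA) v
  calc sqNorm (mix A v) ≤ ∑ i, ∑ j, A i j * ‖v j‖ ^ 2 := Finset.sum_le_sum fun i _ => jensen i
    _ = sqNorm v := by
      rw [Finset.sum_comm]
      simp [← Finset.sum_mul, sum_col_of_mem_doublyStochastic hA, sqNorm]

variable {W : ℕ → Matrix (Fin n) (Fin n) ℝ}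

lemma sweep_mem_doublyStochastic (hW : ∀ l, W l ∈ doublyStochastic ℝ (Fin n)) (m : ℕ) :
    sweep W m ∈ doublyStochastic ℝ (Fin n) := by
  induction m with
  | zero => exact one_mem _
  | succ m ih => exact mul_mem (hW m) ih

lemma sweep_add (W : ℕ → Matrix (Fin n) (Fin n) ℝ) (a b : ℕ) :
    sweep W (a + b) = sweep (fun l => W (a + l)) b * sweep W a := by
  induction b with
  | zero => simp [sweep]
  | succ b ih => rw [← add_assoc, sweep, ih, sweep, mul_assoc]

lemma sweep_congr {W' : ℕ → Matrix (Fin n) (Fin n) ℝ} {m : ℕ} (h : ∀ l < m, W l = W' l) :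
    sweep W m = sweep W' m := by
  induction m with
  | zero => rfl
  | succ m ih => rw [sweep, sweep, h m m.lt_succ_self, ih fun l hl => h l (hl.trans m.lt_succ_self)]

lemma FiniteTimeConsensus.mod_mem {τ : ℕ} (hW : FiniteTimeConsensus τ W) (l : ℕ) :
    W (l % τ) ∈ _root_.doublyStochastic ℝ (Fin n) :=
  hW.doublyStochastic _ (Nat.mod_lt _ hW.one_le)

lemma FiniteTimeConsensus.sweep_mod_mem {τ : ℕ} (hW : FiniteTimeConsensus τ W)
    (a m : ℕ) : sweep (fun l => W ((a + l) % τ)) m ∈ _root_.doublyStochastic ℝ (Fin n) :=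
  sweep_mem_doublyStochastic (fun _ => hW.mod_mem _) m

lemma exists_le_add_mod_eq_zero {τ : ℕ} (hτ : 1 ≤ τ) (a : ℕ) : ∃ r ≤ τ, (a + r) % τ = 0 := by
  refine ⟨τ - a % τ, Nat.sub_le _ _, ?_⟩
  have : a + (τ - a % τ) = τ * (a / τ + 1) := by
    have := Nat.div_add_mod a τ
    have := Nat.mod_lt a hτ
    rw [mul_add]
    omega
  rw [this, Nat.mul_mod_right]

lemma FiniteTimeConsensus.mix_sweep_deviation_eq_zero {τ : ℕ} (hW : FiniteTimeConsensus τ W)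
    (a : ℕ) {m : ℕ} (hm : 2 * τ ≤ m) (v : Fin n → Vec d) :
    mix (sweep (fun l => W ((a + l) % τ)) m) (deviation v) = 0 := by
  -- Any two consecutive periods contain a full sweep.
  obtain ⟨r, hr, hra⟩ := exists_le_add_mod_eq_zero hW.one_le a
  obtain ⟨e, rfl⟩ : ∃ e, m = r + (τ + e) := ⟨m - r - τ, by omega⟩
  have full_sweep : sweep (fun l => W ((a + (r + l)) % τ)) τ = Matrix.of fun _ _ => (n : ℝ)⁻¹ := by
    rw [← hW.sweep_eq]
    refine sweep_congr fun l hl => ?_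
    rw [← add_assoc, Nat.add_mod, hra, zero_add, Nat.mod_mod, Nat.mod_eq_of_lt hl]
  rw [sweep_add, sweep_add, mix_mul, mix_mul, full_sweep,
    ← deviation_mix (hW.sweep_mod_mem a r), mix_averaging, avg_deviation]
  exact (isLinearMap_mix _).map_zero

lemma mixSchedule_mem_doublyStochastic {V : ℕ → Matrix (Fin n) (Fin n) ℝ} {τ : ℕ}
    (hW : FiniteTimeConsensus τ W) (hV : ∀ k < τ, V k ∈ doublyStochastic ℝ (Fin n)) (k : ℕ) :
    mixSchedule τ V W k ∈ doublyStochastic ℝ (Fin n) := by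
  unfold mixSchedule
  split_ifs with hk
  · exact hV k hk
  · exact hW.mod_mem k

lemma trackSchedule_mem_doublyStochastic {U : ℕ → Matrix (Fin n) (Fin n) ℝ} {τ : ℕ}
    (hU : ∀ k ≤ τ, U k ∈ doublyStochastic ℝ (Fin n)) (k : ℕ) :
    trackSchedule τ U k ∈ doublyStochastic ℝ (Fin n) := by
  unfold trackSchedule
  split_ifs with hk
  · exact hU k hk
  · exact one_mem _

end Mixing

/-! ### Deviations of gradient tracking -/

section Unrolling

variable {n d : ℕ} {M : ℕ → Matrix (Fin n) (Fin n) ℝ} {g x z : ℕ → Fin n → Vec d} {α : ℝ}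

lemma tracking_eq_sum (hg₀ : g 0 = z 0) (hg : ∀ p, g (p + 1) = mix (M p) (g p) + z (p + 1))
    (p : ℕ) :
    g p = ∑ q ∈ Finset.range (p + 1), mix (sweep (fun l => M (q + l)) (p - q)) (z q) := by
  induction p with
  | zero => simp [sweep, mix_one, hg₀]
  | succ p ih =>
    have mix_term : ∀ q ∈ Finset.range (p + 1),
        mix (M p) (mix (sweep (fun l => M (q + l)) (p - q)) (z q))
          = mix (sweep (fun l => M (q + l)) (p + 1 - q)) (z q) := fun q hq => by
      have hqp : q ≤ p := Nat.lt_succ_iff.1 (Finset.mem_range.1 hq)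
      rw [Nat.succ_sub hqp, sweep, mix_mul, Nat.add_sub_cancel' hqp]
    rw [Finset.sum_range_succ, hg, ih, mix_sum, Finset.sum_congr rfl mix_term]
    simp [sweep, mix_one]

lemma parameter_eq_sum (hg₀ : g 0 = z 0) (hg : ∀ p, g (p + 1) = mix (M p) (g p) + z (p + 1))
    (hx₀ : x 0 = 0) (hx : ∀ p, x (p + 1) = mix (M p) (x p - α • g p)) (p : ℕ) :
    x p = -α • ∑ q ∈ Finset.range p,
      ((p - q : ℕ) : ℝ) • mix (sweep (fun l => M (q + l)) (p - q)) (z q) := by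
  induction p with
  | zero => simp [hx₀]
  | succ p ih =>
    have mix_term : ∀ q ∈ Finset.range (p + 1),
        mix (M p) (((p - q : ℕ) : ℝ) • mix (sweep (fun l => M (q + l)) (p - q)) (z q)
            + mix (sweep (fun l => M (q + l)) (p - q)) (z q))
          = ((p + 1 - q : ℕ) : ℝ) • mix (sweep (fun l => M (q + l)) (p + 1 - q)) (z q) :=
      fun q hq => by
        have hqp : q ≤ p := Nat.lt_succ_iff.1 (Finset.mem_range.1 hq)
        rw [Nat.succ_sub hqp, sweep, mix_mul, Nat.add_sub_cancel' hqp, Nat.cast_succ,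
          add_smul, one_smul, (isLinearMap_mix _).map_add, (isLinearMap_mix _).map_smul]
    have hx_succ : x p = -α • ∑ q ∈ Finset.range (p + 1),
        ((p - q : ℕ) : ℝ) • mix (sweep (fun l => M (q + l)) (p - q)) (z q) := by
      rw [Finset.sum_range_succ, Nat.sub_self, Nat.cast_zero, zero_smul, add_zero, ← ih]
    rw [hx, hx_succ, tracking_eq_sum hg₀ hg p, sub_eq_add_neg, ← neg_smul, ← smul_add,
      ← Finset.sum_add_distrib, (isLinearMap_mix _).map_smul, mix_sum,
      Finset.sum_congr rfl mix_term]

end Unrolling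

section Lag

/-- The weight with which the gradient increment of `m` iterations ago enters the deviation of the
parameters: `m`, until a full sweep has annihilated the increment. -/
noncomputable def lag (τ m : ℕ) : ℝ := if m < 2 * τ then (m : ℝ) else 0

lemma lag_nonneg (τ m : ℕ) : 0 ≤ lag τ m := by unfold lag; split_ifs <;> positivity

lemma lag_le (τ m : ℕ) : lag τ m ≤ 2 * τ := by
  unfold lag
  split_ifs with h
  · exact_mod_cast h.le
  · positivity

lemma lag_zero (τ : ℕ) : lag τ 0 = 0 := by simp [lag]

lemma sum_lag_le (τ P : ℕ) : ∑ m ∈ Finset.range P, lag τ m ≤ 2 * (τ : ℝ) ^ 2 := by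
  have gauss : (∑ m ∈ Finset.range (2 * τ), m) * 2 ≤ (2 * τ) * (2 * τ) := by
    rw [Finset.sum_range_id_mul_two]
    exact Nat.mul_le_mul_left _ (Nat.sub_le _ _)
  calc ∑ m ∈ Finset.range P, lag τ m ≤ ∑ m ∈ Finset.range (2 * τ), (m : ℝ) := by
        simp only [lag, ← Finset.sum_filter]
        refine Finset.sum_le_sum_of_subset_of_nonneg (fun m hm => ?_)
          fun _ _ _ => Nat.cast_nonneg _
        exact Finset.mem_range.2 (Finset.mem_filter.1 hm).2
    _ ≤ 2 * (τ : ℝ) ^ 2 := by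
        rify at gauss
        linarith

lemma sum_lag_sub_left_le (τ p : ℕ) :
    ∑ q ∈ Finset.range p, lag τ (p - q) ≤ 2 * (τ : ℝ) ^ 2 := by
  have reflect : ∑ q ∈ Finset.range (p + 1), lag τ (p - q)
      = ∑ q ∈ Finset.range (p + 1), lag τ q := by
    simpa using Finset.sum_range_reflect (lag τ) (p + 1)
  rw [Finset.sum_range_succ, Nat.sub_self, lag_zero, add_zero] at reflect
  exact reflect.trans_le (sum_lag_le _ _)

lemma sum_lag_sub_right_le (τ P q : ℕ) :
    ∑ p ∈ Finset.range P, lag τ (p - q) ≤ 2 * (τ : ℝ) ^ 2 := by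
  have eq_zero : ∀ p ≤ q, lag τ (p - q) = 0 := fun p hp => by
    rw [Nat.sub_eq_zero_of_le hp, lag_zero]
  rcases le_total P q with h | h
  · rw [Finset.sum_eq_zero fun p hp => eq_zero p ((Finset.mem_range.1 hp).le.trans h)]
    positivity
  · obtain ⟨r, rfl⟩ := Nat.exists_eq_add_of_le h
    rw [Finset.sum_range_add, Finset.sum_eq_zero fun p hp => eq_zero p (Finset.mem_range.1 hp).le]
    simpa using sum_lag_le τ r

lemma sum_lag_sq_le (τ p : ℕ) :
    ∑ q ∈ Finset.range p, lag τ (p - q) ^ 2 ≤ 4 * (τ : ℝ) ^ 3 := by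
  calc ∑ q ∈ Finset.range p, lag τ (p - q) ^ 2
      ≤ 2 * τ * ∑ q ∈ Finset.range p, lag τ (p - q) := by
        simp only [Finset.mul_sum, sq]
        gcongr with q
        exacts [lag_nonneg _ _, lag_le _ _]
    _ ≤ 2 * τ * (2 * (τ : ℝ) ^ 2) := by gcongr; exact sum_lag_sub_left_le τ p
    _ = 4 * (τ : ℝ) ^ 3 := by ring

lemma sum_sum_lag_mul_le (τ P : ℕ) {y : ℕ → ℝ} (hy : ∀ q, 0 ≤ y q) :
    ∑ p ∈ Finset.range (P + 1), ∑ q ∈ Finset.range p, lag τ (p - q) * y q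
      ≤ 2 * (τ : ℝ) ^ 2 * ∑ q ∈ Finset.range P, y q := by
  calc ∑ p ∈ Finset.range (P + 1), ∑ q ∈ Finset.range p, lag τ (p - q) * y q
      ≤ ∑ p ∈ Finset.range (P + 1), ∑ q ∈ Finset.range P, lag τ (p - q) * y q := by
        refine Finset.sum_le_sum fun p hp => Finset.sum_le_sum_of_subset_of_nonneg ?_
          fun q _ _ => mul_nonneg (lag_nonneg _ _) (hy q)
        exact Finset.range_subset_range.2 (Nat.lt_succ_iff.1 (Finset.mem_range.1 hp))
    _ = ∑ q ∈ Finset.range P, (∑ p ∈ Finset.range (P + 1), lag τ (p - q)) * y q := by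
        simp only [Finset.sum_mul]
        exact Finset.sum_comm
    _ ≤ 2 * (τ : ℝ) ^ 2 * ∑ q ∈ Finset.range P, y q := by
        rw [Finset.mul_sum]
        gcongr with q
        exacts [hy q, sum_lag_sub_right_le _ _ _]

end Lag

/-- `x, g` is the sample path of gradient tracking with mixing matrices `A`, additional averaging
`B` and step size `α` that is driven by the stochastic gradients `s`. -/
structure IsTracking {n d : ℕ} (A B : ℕ → Matrix (Fin n) (Fin n) ℝ) (α : ℝ)
    (x g s : ℕ → Fin n → Vec d) : Prop where
  init : g 0 = mix (B 0) (s 0)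
  step_x : ∀ k, x (k + 1) = mix (A k) (x k - α • g k)
  step_g : ∀ k, g (k + 1) = mix (B (k + 1)) (mix (A k) (g k) + s (k + 1) - s k)

namespace IsTracking

section General

variable {n d : ℕ} {A B : ℕ → Matrix (Fin n) (Fin n) ℝ} {α : ℝ} {x g s : ℕ → Fin n → Vec d}
  (h : IsTracking A B α x g s) (hA : ∀ k, A k ∈ doublyStochastic ℝ (Fin n))
  (hB : ∀ k, B k ∈ doublyStochastic ℝ (Fin n))

include h hA hB

lemma avg_g (k : ℕ) : avg (g k) = avg (s k) := by
  induction k with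
  | zero => rw [h.init, avg_mix (hB 0)]
  | succ k ih =>
    rw [h.step_g, avg_mix (hB _), isLinearMap_avg.map_sub, isLinearMap_avg.map_add,
      avg_mix (hA _), ih, add_sub_cancel_left]

lemma avg_x_succ (k : ℕ) : avg (x (k + 1)) = avg (x k) - α • avg (s k) := by
  rw [h.step_x, avg_mix (hA _), isLinearMap_avg.map_sub, isLinearMap_avg.map_smul,
    h.avg_g hA hB]

omit hB

lemma deviation_x_succ (k : ℕ) :
    deviation (x (k + 1)) = mix (A k) (deviation (x k) - α • deviation (g k)) := by
  rw [h.step_x, deviation_mix (hA k), isLinearMap_deviation.map_sub,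
    isLinearMap_deviation.map_smul]

lemma mix_deviation_g_eq_zero (hα : α ≠ 0) {k : ℕ} (hx : deviation (x k) = 0)
    (hx' : deviation (x (k + 1)) = 0) : mix (A k) (deviation (g k)) = 0 := by
  have := h.deviation_x_succ hA k
  rw [hx, hx', zero_sub, ← neg_smul, (isLinearMap_mix _).map_smul, eq_comm] at this
  exact (smul_eq_zero.1 this).resolve_left (neg_ne_zero.2 hα)

include hB

lemma deviation_g_succ (k : ℕ) : deviation (g (k + 1))
    = mix (B (k + 1)) (mix (A k) (deviation (g k)) + deviation (s (k + 1) - s k)) := by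
  rw [h.step_g, deviation_mix (hB _), add_sub_assoc, isLinearMap_deviation.map_add,
    deviation_mix (hA k)]

lemma deviation_eq_sum (hα : α ≠ 0) {t : ℕ} (hx : deviation (x t) = 0)
    (hx' : deviation (x (t + 1)) = 0) (hB_one : ∀ k, t + 1 < k → B k = 1) (p : ℕ) :
    deviation (x (t + 1 + p)) = -α • ∑ q ∈ Finset.range p, ((p - q : ℕ) : ℝ) •
      mix (sweep (fun l => A (t + 1 + (q + l))) (p - q))
        (mix (B (t + 1 + q)) (deviation (s (t + 1 + q) - s (t + q)))) := by
  refine parameter_eq_sum (M := fun p => A (t + 1 + p)) (g := fun p => deviation (g (t + 1 + p)))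
    (x := fun p => deviation (x (t + 1 + p)))
    (z := fun q => mix (B (t + 1 + q)) (deviation (s (t + 1 + q) - s (t + q))))
    ?_ (fun p => ?_) hx' (fun p => h.deviation_x_succ hA (t + 1 + p)) p
  · simp only [add_zero]
    rw [h.deviation_g_succ hA hB, h.mix_deviation_g_eq_zero hA hα hx hx', zero_add]
  · have hsucc := h.deviation_g_succ hA hB (t + 1 + p)
    rw [hB_one _ (by omega), mix_one] at hsucc
    simp only [hB_one _ (show t + 1 < t + 1 + (p + 1) by omega), mix_one]
    rwa [show t + (p + 1) = t + 1 + p by ring]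

end General

/-- A full sweep annihilates deviations. Hence, if the agents agree at the last two iterations of
the warm-up, later deviations only involve the gradient increments of the last two periods. -/
lemma deviation_eq_sum_lag {n d : ℕ} {W V U : ℕ → Matrix (Fin n) (Fin n) ℝ} {α : ℝ}
    {x g s : ℕ → Fin n → Vec d} {t : ℕ}
    (h : IsTracking (mixSchedule (t + 1) V W) (trackSchedule (t + 1) U) α x g s)
    (hW : FiniteTimeConsensus (t + 1) W) (hV : ∀ k < t + 1, V k ∈ doublyStochastic ℝ (Fin n))
    (hU : ∀ k ≤ t + 1, U k ∈ doublyStochastic ℝ (Fin n)) (hα : α ≠ 0)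
    (hx : deviation (x t) = 0) (hx' : deviation (x (t + 1)) = 0) (p : ℕ) :
    deviation (x (t + 1 + p)) = -α • deviation (∑ q ∈ Finset.range p, lag (t + 1) (p - q) •
      mix (sweep (fun l => W ((q + l) % (t + 1))) (p - q) * trackSchedule (t + 1) U (t + 1 + q))
        (s (t + 1 + q) - s (t + q))) := by
  have hA := mixSchedule_mem_doublyStochastic hW hV
  have hB := trackSchedule_mem_doublyStochastic hU
  have hA_eq (l : ℕ) : mixSchedule (t + 1) V W (t + 1 + l) = W (l % (t + 1)) := by
    rw [mixSchedule, if_neg (by omega), Nat.add_mod_left]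
  rw [h.deviation_eq_sum hA hB hα hx hx' fun k hk => if_neg (by omega), deviation_sum_smul]
  simp only [hA_eq, mix_mul]
  congr 1
  refine Finset.sum_congr rfl fun q _ => ?_
  rw [deviation_mix (hW.sweep_mod_mem q (p - q)), deviation_mix (hB _), lag]
  split_ifs with hlag
  · rfl
  · rw [← deviation_mix (hB _), hW.mix_sweep_deviation_eq_zero q (not_lt.1 hlag), smul_zero,
      smul_zero]

end IsTracking

/-! ### Smooth functions -/

section Smooth

variable {E : Type*} [NormedAddCommGroup E] [InnerProductSpace ℝ E] [CompleteSpace E]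
  {f : E → ℝ} {L : ℝ}

lemma hasDerivAt_comp_add_smul (hf : Differentiable ℝ f) (x v : E) (t : ℝ) :
    HasDerivAt (fun t : ℝ => f (x + t • v)) (inner ℝ (gradient f (x + t • v)) v) t := by
  rw [inner_gradient_left]
  exact (hf (x + t • v)).hasFDerivAt.comp_hasDerivAt t
    (by simpa using ((hasDerivAt_id t).smul_const v).const_add x)

lemma apply_add_le_of_lipschitz_gradient (hf : Differentiable ℝ f)
    (hL : ∀ x y, ‖gradient f x - gradient f y‖ ≤ L * ‖x - y‖) (x v : E) :
    f (x + v) ≤ f x + inner ℝ (gradient f x) v + L / 2 * ‖v‖ ^ 2 := by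
  let gap (t : ℝ) := f (x + t • v) - (t * inner ℝ (gradient f x) v + t ^ 2 * (L / 2 * ‖v‖ ^ 2))
  have hgap (t : ℝ) : HasDerivAt gap (inner ℝ (gradient f (x + t • v)) v
      - (inner ℝ (gradient f x) v + 2 * t * (L / 2 * ‖v‖ ^ 2))) t :=
    (hasDerivAt_comp_add_smul hf x v t).sub
      ((((hasDerivAt_id t).mul_const _).add ((hasDerivAt_pow 2 t).mul_const _)).congr_deriv
        (by simp))
  have gap_antitone : AntitoneOn gap (Set.Icc 0 1) := by
    refine antitoneOn_of_deriv_nonpos (convex_Icc 0 1)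
      (fun t _ => (hgap t).continuousAt.continuousWithinAt)
      (fun t _ => (hgap t).differentiableAt.differentiableWithinAt) fun t ht => ?_
    rw [interior_Icc] at ht
    have cauchy_schwarz := real_inner_le_norm (gradient f (x + t • v) - gradient f x) v
    have lipschitz := hL (x + t • v) x
    rw [inner_sub_left] at cauchy_schwarz
    rw [add_sub_cancel_left, norm_smul, Real.norm_of_nonneg ht.1.le] at lipschitz
    rw [(hgap t).deriv]
    nlinarith [norm_nonneg v]
  have := gap_antitone (Set.left_mem_Icc.2 zero_le_one) (Set.right_mem_Icc.2 zero_le_one)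
    zero_le_one
  simp only [gap, one_smul, zero_smul, one_mul, one_pow, add_zero] at this
  linarith

lemma norm_gradient_sq_le_of_lipschitz_gradient (hf : Differentiable ℝ f) (hpos : 0 < L)
    (hL : ∀ x y, ‖gradient f x - gradient f y‖ ≤ L * ‖x - y‖) {m : ℝ} (hm : ∀ x, m ≤ f x)
    (x : E) : ‖gradient f x‖ ^ 2 ≤ 2 * L * (f x - m) := by
  -- Minimize the quadratic upper bound of `f` along the gradient.
  have h := (hm _).trans (apply_add_le_of_lipschitz_gradient hf hL x (-(L⁻¹ • gradient f x)))
  rw [inner_neg_right, real_inner_smul_right, real_inner_self_eq_norm_sq, norm_neg, norm_smul,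
    Real.norm_of_nonneg (inv_nonneg.2 hpos.le)] at h
  have hm_le : m ≤ f x - ‖gradient f x‖ ^ 2 / (2 * L) := by
    refine h.trans_eq ?_
    field_simp
    ring
  have := (div_le_iff₀ (by positivity)).1 (le_sub_comm.1 hm_le)
  linarith

lemma apply_sub_smul_le_of_lipschitz_gradient (hf : Differentiable ℝ f)
    (hL : ∀ x y, ‖gradient f x - gradient f y‖ ≤ L * ‖x - y‖) (α : ℝ) (x g e : E) :
    f (x - α • (g + e)) ≤ f x
      - α / 2 * ‖gradient f x‖ ^ 2 - α / 2 * (1 - L * α) * ‖g‖ ^ 2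
      + α / 2 * ‖g - gradient f x‖ ^ 2 + L * α ^ 2 / 2 * ‖e‖ ^ 2
      - α * inner ℝ (gradient f x) e + L * α ^ 2 * inner ℝ g e := by
  have h := apply_add_le_of_lipschitz_gradient hf hL x (-(α • (g + e)))
  rw [← sub_eq_add_neg, norm_neg, norm_smul, inner_neg_right, real_inner_smul_right,
    inner_add_right, mul_pow, Real.norm_eq_abs, sq_abs, norm_add_sq_real] at h
  rw [norm_sub_sq_real, real_inner_comm]
  linarith

end Smooth

namespace SmoothProblem

variable {n d : ℕ} {Ξ : Fin n → Type*} [∀ i, MeasurableSpace (Ξ i)]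
  {P : ∀ i, Measure (Ξ i)} {F : ∀ i, Vec d → Ξ i → ℝ} {L : ℝ} (h : SmoothProblem P F L)

include h

lemma hasFDerivAt_obj (x : Vec d) :
    HasFDerivAt (obj P F) ((n : ℝ)⁻¹ • ∑ i, fderiv ℝ (localObj P F i) x) x :=
  (HasFDerivAt.fun_sum (u := Finset.univ) fun i _ =>
    ((h.contDiff i).differentiable one_ne_zero x).hasFDerivAt).const_mul (n : ℝ)⁻¹

lemma differentiable_obj : Differentiable ℝ (obj P F) :=
  fun x => (h.hasFDerivAt_obj x).differentiableAt

lemma gradient_obj (x : Vec d) : gradient (obj P F) x = avg (trueGrad P F fun _ => x) := by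
  simp [gradient, (h.hasFDerivAt_obj x).fderiv, avg, trueGrad]

lemma sqNorm_trueGrad_sub_le (x y : Fin n → Vec d) :
    sqNorm (trueGrad P F x - trueGrad P F y) ≤ L ^ 2 * sqNorm (x - y) := by
  simp only [sqNorm, Finset.mul_sum, ← mul_pow]
  gcongr with i
  exact h.lipschitz i _ _

lemma norm_trueGrad_sub_le (x y : Fin n → Vec d) :
    ‖trueGrad P F x - trueGrad P F y‖ ≤ L * ‖x - y‖ := by
  have hL := h.pos
  refine (pi_norm_le_iff_of_nonneg (by positivity)).2 fun i => (h.lipschitz i _ _).trans ?_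
  gcongr
  exact norm_le_pi_norm (x - y) i

lemma norm_avg_trueGrad_sub_sq_le (x y : Fin n → Vec d) :
    ‖avg (trueGrad P F x) - avg (trueGrad P F y)‖ ^ 2 ≤ (n : ℝ)⁻¹ * (L ^ 2 * sqNorm (x - y)) := by
  rw [← isLinearMap_avg.map_sub]
  exact (norm_avg_sq_le _).trans (by gcongr; exact h.sqNorm_trueGrad_sub_le x y)

lemma norm_avg_trueGrad_sub_gradient_sq_le (x : Fin n → Vec d) :
    ‖avg (trueGrad P F x) - gradient (obj P F) (avg x)‖ ^ 2
      ≤ (n : ℝ)⁻¹ * (L ^ 2 * sqNorm (deviation x)) := by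
  rw [h.gradient_obj]
  exact h.norm_avg_trueGrad_sub_sq_le x _

lemma lipschitz_obj (x y : Vec d) :
    ‖gradient (obj P F) x - gradient (obj P F) y‖ ≤ L * ‖x - y‖ := by
  have hL := h.pos
  refine le_of_sq_le_sq ?_ (by positivity)
  rw [h.gradient_obj, h.gradient_obj]
  refine (h.norm_avg_trueGrad_sub_sq_le _ _).trans ?_
  rcases n.eq_zero_or_pos with rfl | hn
  · simpa using sq_nonneg (L * ‖x - y‖)
  · refine le_of_eq ?_
    simp only [sqNorm, Pi.sub_apply, Finset.sum_const, Finset.card_univ, Fintype.card_fin,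
      nsmul_eq_mul]
    field_simp

lemma optVal_le (x : Vec d) : optVal P F ≤ obj P F x := ciInf_le h.bddBelow x

lemma norm_gradient_obj_sq_le (x : Vec d) :
    ‖gradient (obj P F) x‖ ^ 2 ≤ 2 * L * (obj P F x - optVal P F) :=
  norm_gradient_sq_le_of_lipschitz_gradient h.differentiable_obj h.pos h.lipschitz_obj h.optVal_le x

lemma continuous_gradient_localObj (i : Fin n) : Continuous (gradient (localObj P F i)) :=
  (InnerProductSpace.toDual ℝ (Vec d)).symm.continuous.comp
    ((h.contDiff i).continuous_fderiv one_ne_zero)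

lemma continuous_trueGrad : Continuous (trueGrad P F) :=
  continuous_pi fun i => (h.continuous_gradient_localObj i).comp (continuous_apply i)

lemma continuous_gradient_obj : Continuous (gradient (obj P F)) := by
  rw [funext h.gradient_obj]
  exact (isLinearMap_avg.mk' avg).continuous_of_finiteDimensional.comp
    (h.continuous_trueGrad.comp (continuous_pi fun _ => continuous_id))

end SmoothProblem

/-! ### Independence and orthogonality -/

section Independence

variable {Ω : Type*} {m mΩ : MeasurableSpace Ω} {μ : Measure Ω}

lemma indep_sup_left_of_indep_sup_right [IsZeroOrProbabilityMeasure μ]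
    {m₀ m₁ m₂ : MeasurableSpace Ω} (h₀ : m₀ ≤ mΩ) (h₁ : m₁ ≤ mΩ) (h₂ : m₂ ≤ mΩ)
    (h : Indep m₀ (m₁ ⊔ m₂) μ) (h' : Indep m₁ m₂ μ) : Indep (m₀ ⊔ m₁) m₂ μ := by
  rw [Indep_iff] at h h'
  let rectangles : Set (Set Ω) :=
    {u | ∃ s t, MeasurableSet[m₀] s ∧ MeasurableSet[m₁] t ∧ s ∩ t = u}
  have isPiSystem_rectangles : IsPiSystem rectangles := by
    rintro _ ⟨s, t, hs, ht, rfl⟩ _ ⟨s', t', hs', ht', rfl⟩ -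
    exact ⟨s ∩ s', t ∩ t', hs.inter hs', ht.inter ht', Set.inter_inter_inter_comm _ _ _ _⟩
  have generateFrom_rectangles : m₀ ⊔ m₁ = MeasurableSpace.generateFrom rectangles := by
    refine le_antisymm (sup_le (fun s hs => ?_) fun t ht => ?_)
      (MeasurableSpace.generateFrom_le ?_)
    · exact MeasurableSpace.measurableSet_generateFrom ⟨s, .univ, hs, .univ, Set.inter_univ s⟩
    · exact MeasurableSpace.measurableSet_generateFrom ⟨.univ, t, .univ, ht, Set.univ_inter t⟩
    · rintro _ ⟨s, t, hs, ht, rfl⟩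
      exact MeasurableSet.inter ((le_sup_left : m₀ ≤ m₀ ⊔ m₁) s hs)
        ((le_sup_right : m₁ ≤ m₀ ⊔ m₁) t ht)
  refine IndepSets.indep (sup_le h₀ h₁) h₂ isPiSystem_rectangles
    (@MeasurableSpace.isPiSystem_measurableSet _ m₂) generateFrom_rectangles
    (@MeasurableSpace.generateFrom_measurableSet _ m₂).symm ((IndepSets_iff _ _ _).2 ?_)
  rintro _ u ⟨s, t, hs, ht, rfl⟩ hu
  have ht' : MeasurableSet[m₁ ⊔ m₂] t := (le_sup_left : m₁ ≤ m₁ ⊔ m₂) t ht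
  have hu' : MeasurableSet[m₁ ⊔ m₂] u := (le_sup_right : m₂ ≤ m₁ ⊔ m₂) u hu
  rw [Set.inter_assoc, h s (t ∩ u) hs (ht'.inter hu'), h' t u ht hu, h s t hs ht', mul_assoc]

section Fubini

variable [IsFiniteMeasure μ] {𝒳 Ξ E : Type*} [MeasurableSpace 𝒳] [MeasurableSpace Ξ]
  [NormedAddCommGroup E] {X : Ω → 𝒳} {ξ : Ω → Ξ} {φ : 𝒳 × Ξ → E}

lemma integrable_prod_map_of_indepFun (hX : Measurable X) (hξ : Measurable ξ)
    (hφ : StronglyMeasurable φ) (hind : IndepFun X ξ μ)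
    (hint : Integrable (fun ω => φ (X ω, ξ ω)) μ) :
    Integrable φ ((μ.map X).prod (μ.map ξ)) := by
  rw [← hind.map_prod_eq_prod_map_map hX.aemeasurable hξ.aemeasurable]
  exact (integrable_map_measure hφ.aestronglyMeasurable (hX.prodMk hξ).aemeasurable).2 hint

variable [NormedSpace ℝ E]

lemma setIntegral_preimage_of_indepFun (hX : Measurable X) (hξ : Measurable ξ)
    (hφ : StronglyMeasurable φ) (hind : IndepFun X ξ μ)
    (hint : Integrable (fun ω => φ (X ω, ξ ω)) μ) {s : Set 𝒳} (hs : MeasurableSet s) :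
    ∫ ω in X ⁻¹' s, φ (X ω, ξ ω) ∂μ = ∫ y in s, ∫ ζ, φ (y, ζ) ∂(μ.map ξ) ∂(μ.map X) := by
  have hpre : (fun ω => (X ω, ξ ω)) ⁻¹' s ×ˢ Set.univ = X ⁻¹' s := by ext; simp
  rw [← hpre, ← setIntegral_map (hs.prod .univ) hφ.aestronglyMeasurable
      (hX.prodMk hξ).aemeasurable, hind.map_prod_eq_prod_map_map hX.aemeasurable hξ.aemeasurable,
    setIntegral_prod _ (integrable_prod_map_of_indepFun hX hξ hφ hind hint).integrableOn,
    Measure.restrict_univ]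

lemma ae_integral_eq_zero_of_condExp_eq_zero [CompleteSpace E]
    (hm : m ≤ mΩ) (hX : Measurable[m] X) (hξ : Measurable ξ) (hφ : StronglyMeasurable φ)
    (hind : IndepFun X ξ μ) (hint : Integrable (fun ω => φ (X ω, ξ ω)) μ)
    (hcondExp : μ[fun ω => φ (X ω, ξ ω) | m] =ᵐ[μ] 0) :
    ∀ᵐ y ∂(μ.map X), ∫ ζ, φ (y, ζ) ∂(μ.map ξ) = 0 := by
  have hX' : Measurable X := hX.mono hm le_rfl
  refine ae_eq_zero_of_forall_setIntegral_eq_of_sigmaFinite (fun s _ _ =>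
    (integrable_prod_map_of_indepFun hX' hξ hφ hind hint).integral_prod_left.integrableOn)
    fun s hs _ => ?_
  rw [← setIntegral_preimage_of_indepFun hX' hξ hφ hind hint hs,
    ← setIntegral_condExp hm hint (hX hs), setIntegral_congr_ae (g := fun _ => 0) (hX' hs)
      (hcondExp.mono fun ω hω _ => hω), integral_zero]

lemma integral_eq_zero_of_indepFun (hX : Measurable X) (hξ : Measurable ξ)
    (hφ : StronglyMeasurable φ) (hind : IndepFun X ξ μ)
    (hint : Integrable (fun ω => φ (X ω, ξ ω)) μ)
    (hcentered : ∀ᵐ y ∂(μ.map X), ∫ ζ, φ (y, ζ) ∂(μ.map ξ) = 0) :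
    ∫ ω, φ (X ω, ξ ω) ∂μ = 0 := by
  have := setIntegral_preimage_of_indepFun hX hξ hφ hind hint MeasurableSet.univ
  rw [Set.preimage_univ, Measure.restrict_univ, Measure.restrict_univ] at this
  rw [this, integral_congr_ae hcentered, integral_zero]

end Fubini

section InnerProduct

variable {E : Type*} [NormedAddCommGroup E] [InnerProductSpace ℝ E]

lemma integrable_inner_of_memLp {Y Z : Ω → E} (hY : MemLp Y 2 μ) (hZ : MemLp Z 2 μ) :
    Integrable (fun ω => (inner ℝ (Y ω) (Z ω) : ℝ)) μ :=
  (hY.norm.integrable_mul hZ.norm).mono' (hY.1.inner hZ.1)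
    (ae_of_all _ fun _ => norm_inner_le_norm _ _)

lemma integral_norm_add_sq_of_integral_inner_eq_zero {Y Z : Ω → E} (hY : MemLp Y 2 μ)
    (hZ : MemLp Z 2 μ) (horth : ∫ ω, inner ℝ (Y ω) (Z ω) ∂μ = 0) :
    ∫ ω, ‖Y ω + Z ω‖ ^ 2 ∂μ = ∫ ω, ‖Y ω‖ ^ 2 ∂μ + ∫ ω, ‖Z ω‖ ^ 2 ∂μ := by
  have integrable_sq_Y := hY.integrable_norm_pow two_ne_zero
  have integrable_inner := (integrable_inner_of_memLp hY hZ).const_mul 2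
  have integrable_sum : Integrable (fun ω => ‖Y ω‖ ^ 2 + 2 * inner ℝ (Y ω) (Z ω)) μ :=
    integrable_sq_Y.add integrable_inner
  simp_rw [norm_add_sq_real]
  rw [integral_add integrable_sum (hZ.integrable_norm_pow two_ne_zero),
    integral_add integrable_sq_Y integrable_inner, integral_const_mul, horth, mul_zero, add_zero]

/-- By Fubini, centering given `m` turns into centering of almost every slice `φ (y, ·)`, and each
centered slice is orthogonal to the constant that `Z` is on it. -/
lemma integral_inner_eq_zero_of_indepFun [CompleteSpace E] [MeasurableSpace E] [BorelSpace E]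
    [SecondCountableTopology E] [IsFiniteMeasure μ] {𝒳 Ξ : Type*} [MeasurableSpace 𝒳]
    [MeasurableSpace Ξ] (hm : m ≤ mΩ) {Z : Ω → E} {X : Ω → 𝒳} {ξ : Ω → Ξ}
    {φ : 𝒳 × Ξ → E} (hZ : Measurable Z) (hX : Measurable[m] X) (hξ : Measurable ξ)
    (hφ : Measurable φ) (hind : IndepFun (fun ω => (Z ω, X ω)) ξ μ) (hZ2 : MemLp Z 2 μ)
    (hφ2 : MemLp (fun ω => φ (X ω, ξ ω)) 2 μ)
    (hcondExp : μ[fun ω => φ (X ω, ξ ω) | m] =ᵐ[μ] 0) :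
    ∫ ω, inner ℝ (Z ω) (φ (X ω, ξ ω)) ∂μ = 0 := by
  have hX' : Measurable X := hX.mono hm le_rfl
  have hZX : Measurable fun ω => (Z ω, X ω) := hZ.prodMk hX'
  have hindX : IndepFun X ξ μ := hind.comp measurable_snd measurable_id
  have hint : Integrable (fun ω => φ (X ω, ξ ω)) μ := hφ2.integrable (by norm_num)
  have integrable_slice := (integrable_prod_map_of_indepFun hX' hξ hφ.stronglyMeasurable hindX
    hint).prod_right_ae
  have centered := ae_integral_eq_zero_of_condExp_eq_zero hm hX hξ hφ.stronglyMeasurable hindX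
    hint hcondExp
  have map_snd : (μ.map fun ω => (Z ω, X ω)).map Prod.snd = μ.map X :=
    Measure.map_map measurable_snd hZX
  rw [← map_snd] at integrable_slice centered
  refine integral_eq_zero_of_indepFun (X := fun ω => (Z ω, X ω))
    (φ := fun p : (E × 𝒳) × Ξ => inner ℝ p.1.1 (φ (p.1.2, p.2))) hZX hξ
    (measurable_fst.fst.inner (hφ.comp (measurable_fst.snd.prodMk measurable_snd))
      ).stronglyMeasurable hind (integrable_inner_of_memLp hZ2 hφ2) ?_
  filter_upwards [ae_of_ae_map measurable_snd.aemeasurable integrable_slice,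
    ae_of_ae_map measurable_snd.aemeasurable centered] with p hp hp'
  rw [integral_inner hp, hp', inner_zero_right]

lemma integral_norm_sum_smul_sq_le {ι : Type*} {N : ι → Ω → E} {v : ℝ}
    (hN : ∀ p, MemLp (N p) 2 μ) (horth : Pairwise fun p q => ∫ ω, inner ℝ (N p ω) (N q ω) ∂μ = 0)
    (hv : ∀ p, ∫ ω, ‖N p ω‖ ^ 2 ∂μ ≤ v) (s : Finset ι) (c : ι → ℝ) :
    ∫ ω, ‖∑ p ∈ s, c p • N p ω‖ ^ 2 ∂μ ≤ (∑ p ∈ s, c p ^ 2) * v := by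
  have hint (p q : ι) : Integrable (fun ω => c p * (c q * inner ℝ (N p ω) (N q ω))) μ :=
    ((integrable_inner_of_memLp (hN p) (hN q)).const_mul _).const_mul _
  have integral_diagonal (p : ι) (hp : p ∈ s) :
      ∑ q ∈ s, ∫ ω, c p * (c q * inner ℝ (N p ω) (N q ω)) ∂μ
        = c p ^ 2 * ∫ ω, ‖N p ω‖ ^ 2 ∂μ := by
    rw [Finset.sum_eq_single_of_mem p hp fun q _ hq => ?_]
    · simp_rw [integral_const_mul, real_inner_self_eq_norm_sq]
      ring
    · simp_rw [integral_const_mul, horth hq.symm, mul_zero]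
  calc ∫ ω, ‖∑ p ∈ s, c p • N p ω‖ ^ 2 ∂μ
      = ∫ ω, ∑ p ∈ s, ∑ q ∈ s, c p * (c q * inner ℝ (N p ω) (N q ω)) ∂μ := by
        simp_rw [← real_inner_self_eq_norm_sq, sum_inner, inner_sum, real_inner_smul_left,
          real_inner_smul_right]
    _ = ∑ p ∈ s, c p ^ 2 * ∫ ω, ‖N p ω‖ ^ 2 ∂μ := by
        rw [integral_finsetSum _ fun p _ => integrable_finsetSum _ fun q _ => hint p q]
        refine Finset.sum_congr rfl fun p hp => ?_
        rw [integral_finsetSum _ fun q _ => hint p q, integral_diagonal p hp]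
    _ ≤ (∑ p ∈ s, c p ^ 2) * v := by
        rw [Finset.sum_mul]
        gcongr with p
        exact hv p

end InnerProduct

end Independence

section Gradient

variable {E Ξ : Type*} [NormedAddCommGroup E] [InnerProductSpace ℝ E] [FiniteDimensional ℝ E]
  [MeasurableSpace E] [BorelSpace E] [MeasurableSpace Ξ] {F : E → Ξ → ℝ}

lemma measurable_gradient_of_measurable_uncurry (hF : Measurable fun p : E × Ξ => F p.1 p.2)
    (hdiff : ∀ ζ, Differentiable ℝ fun x => F x ζ) :
    Measurable fun p : E × Ξ => gradient (fun y => F y p.2) p.1 := by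
  let b := stdOrthonormalBasis ℝ E
  have measurable_coordinate (v : E) :
      Measurable fun p : E × Ξ => inner ℝ v (gradient (fun y => F y p.2) p.1) := by
    refine measurable_of_tendsto_metrizable (f := fun (k : ℕ) (p : E × Ξ) =>
      (k : ℝ) • (F (p.1 + (k : ℝ)⁻¹ • v) p.2 - F p.1 p.2)) (fun k => ?_)
      (tendsto_pi_nhds.2 fun p => ?_)
    · exact ((hF.comp ((measurable_fst.add_const _).prodMk measurable_snd)).sub hF).const_smul
        (k : ℝ)
    · rw [real_inner_comm, inner_gradient_left]
      exact ((hdiff p.2 p.1).hasFDerivAt.lim_real v).comp tendsto_natCast_atTop_atTop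
  have sum_coordinates : (fun p : E × Ξ => gradient (fun y => F y p.2) p.1)
      = fun p => ∑ i, (inner ℝ (b i) (gradient (fun y => F y p.2) p.1) : ℝ) • b i :=
    funext fun p => (b.sum_repr' _).symm
  rw [sum_coordinates]
  exact Finset.measurable_sum _ fun i _ => (measurable_coordinate (b i)).smul_const (b i)

end Gradient

/-! ### The gradient noise along the iterates -/

section LinearImages

variable {E E' : Type*} [NormedAddCommGroup E] [NormedSpace ℝ E] [FiniteDimensional ℝ E]
  [NormedAddCommGroup E'] [NormedSpace ℝ E'] {T : E → E'}

lemma continuous_of_isLinearMap (hT : IsLinearMap ℝ T) : Continuous T :=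
  (hT.mk' T).continuous_of_finiteDimensional

lemma memLp_comp_of_isLinearMap {Ω : Type*} {_ : MeasurableSpace Ω} {μ : Measure Ω} {p : ℝ≥0∞}
    {v : Ω → E} (hT : IsLinearMap ℝ T) (hv : MemLp v p μ) : MemLp (fun ω => T (v ω)) p μ :=
  (LinearMap.toContinuousLinearMap (hT.mk' T)).comp_memLp' hv

end LinearImages

section Measurability

variable {n d : ℕ} {Ξ : Fin n → Type*} [∀ i, MeasurableSpace (Ξ i)]
  {P : ∀ i, Measure (Ξ i)} {F : ∀ i, Vec d → Ξ i → ℝ} {L α : ℝ}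
  {Ω : Type*} {mΩ : MeasurableSpace Ω}

lemma measurable_mix (A : Matrix (Fin n) (Fin n) ℝ) :
    Measurable (mix A : (Fin n → Vec d) → Fin n → Vec d) :=
  (continuous_of_isLinearMap (isLinearMap_mix A)).measurable

lemma measurable_avg : Measurable (avg : (Fin n → Vec d) → Vec d) :=
  (continuous_of_isLinearMap isLinearMap_avg).measurable

lemma LossRegular.measurable_stochGrad (hF : LossRegular P F) {x : Ω → Fin n → Vec d}
    {ζ : ∀ i, Ω → Ξ i} (hx : Measurable x) (hζ : ∀ i, Measurable (ζ i)) :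
    Measurable fun ω => stochGrad F (x ω) fun i => ζ i ω :=
  measurable_pi_lambda _ fun i =>
    (measurable_gradient_of_measurable_uncurry (hF.measurable i) (hF.differentiable i)).comp
      (((measurable_pi_apply i).comp hx).prodMk (hζ i))

variable {x₀ : Ω → Fin n → Vec d} {ξ : ℕ → ∀ i, Ω → Ξ i}

lemma LossRegular.measurable_gradTracking (hF : LossRegular P F)
    (A B : ℕ → Matrix (Fin n) (Fin n) ℝ) (α : ℝ) (hx₀ : Measurable x₀) (k : ℕ) :
    ((∀ l < k, ∀ i, Measurable (ξ l i)) →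
      Measurable fun ω => (gradTracking F A B α (x₀ ω) (fun j i => ξ j i ω) k).1) ∧
    ((∀ l < k + 1, ∀ i, Measurable (ξ l i)) →
      Measurable fun ω => (gradTracking F A B α (x₀ ω) (fun j i => ξ j i ω) k).2) := by
  induction k with
  | zero =>
    exact ⟨fun _ => hx₀,
      fun hξ => (measurable_mix _).comp (hF.measurable_stochGrad hx₀ (hξ 0 zero_lt_one))⟩
  | succ k ih =>
    have measurable_fst_succ (hξ : ∀ l < k + 1, ∀ i, Measurable (ξ l i)) :
        Measurable fun ω => (gradTracking F A B α (x₀ ω) (fun j i => ξ j i ω) (k + 1)).1 :=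
      (measurable_mix _).comp
        ((ih.1 fun l hl => hξ l (by omega)).sub ((ih.2 hξ).const_smul α))
    refine ⟨measurable_fst_succ, fun hξ => ?_⟩
    have hξ' : ∀ l < k + 1, ∀ i, Measurable (ξ l i) := fun l hl => hξ l (by omega)
    exact (measurable_mix _).comp ((((measurable_mix _).comp (ih.2 hξ')).add
      (hF.measurable_stochGrad (measurable_fst_succ hξ') (hξ (k + 1) (by omega)))).sub
      (hF.measurable_stochGrad (ih.1 fun l hl => hξ l (by omega)) (hξ k (by omega))))

variable {W V U : ℕ → Matrix (Fin n) (Fin n) ℝ} {τ : ℕ}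

lemma LossRegular.measurable_iterates (hF : LossRegular P F) (hx₀ : Measurable x₀) {k : ℕ}
    (hξ : ∀ l < k, ∀ i, Measurable (ξ l i)) : Measurable (iterates F τ W V U α x₀ ξ k) :=
  (hF.measurable_gradTracking _ _ _ hx₀ k).1 hξ

/-- The gradient noise `∇F_i (x_i; ζ) - ∇f_i (x_i)` of agent `i` as a deterministic function of the
stacked parameters `x` and the sample `ζ`. -/
noncomputable def noiseFun (P : ∀ i, Measure (Ξ i)) (F : ∀ i, Vec d → Ξ i → ℝ) (i : Fin n)
    (p : (Fin n → Vec d) × Ξ i) : Vec d :=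
  gradient (fun y => F i y p.2) (p.1 i) - gradient (localObj P F i) (p.1 i)

lemma measurable_noiseFun (hF : LossRegular P F) (hS : SmoothProblem P F L) (i : Fin n) :
    Measurable (noiseFun P F i) := by
  have measurable_block : Measurable fun p : (Fin n → Vec d) × Ξ i => p.1 i :=
    (measurable_pi_apply i).comp measurable_fst
  exact ((measurable_gradient_of_measurable_uncurry (hF.measurable i) (hF.differentiable i)).comp
    (measurable_block.prodMk measurable_snd)).sub
    ((hS.continuous_gradient_localObj i).measurable.comp measurable_block)

lemma measurable_history (x : ℕ → Ω → Fin n → Vec d) (k : ℕ) : Measurable[history x k] (x k) :=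
  measurable_iff_comap_le.2 <| le_iSup₂_of_le
    (f := fun (j : ℕ) (_ : j ∈ Finset.range (k + 1)) => MeasurableSpace.comap (x j) inferInstance)
    k (Finset.self_mem_range_succ k) le_rfl

lemma history_le {x : ℕ → Ω → Fin n → Vec d} (hx : ∀ k, Measurable (x k)) (k : ℕ) :
    history x k ≤ mΩ :=
  iSup₂_le fun j _ => (hx j).comap_le

/-- The `σ`-algebra generated by the initial condition and by all samples except `ξ q.1 q.2`. -/
@[reducible] def otherSamples (x₀ : Ω → Fin n → Vec d) (ξ : ℕ → ∀ i, Ω → Ξ i)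
    (q : ℕ × Fin n) : MeasurableSpace Ω :=
  MeasurableSpace.comap x₀ inferInstance ⊔
    ⨆ p ∈ ({q}ᶜ : Set (ℕ × Fin n)), MeasurableSpace.comap (ξ p.1 p.2) inferInstance

lemma otherSamples_le (hx₀ : Measurable x₀) (hξ : ∀ k i, Measurable (ξ k i)) (q : ℕ × Fin n) :
    otherSamples x₀ ξ q ≤ mΩ :=
  sup_le hx₀.comap_le (iSup₂_le fun p _ => (hξ p.1 p.2).comap_le)

lemma measurable_otherSamples_init (q : ℕ × Fin n) : Measurable[otherSamples x₀ ξ q] x₀ :=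
  measurable_iff_comap_le.2 le_sup_left

lemma measurable_otherSamples_sample {p q : ℕ × Fin n} (hpq : p ≠ q) :
    Measurable[otherSamples x₀ ξ q] (ξ p.1 p.2) :=
  measurable_iff_comap_le.2 <| le_sup_of_le_right <| le_iSup₂_of_le
    (f := fun (p : ℕ × Fin n) (_ : p ∈ ({q}ᶜ : Set (ℕ × Fin n))) =>
      MeasurableSpace.comap (ξ p.1 p.2) inferInstance) p hpq le_rfl

lemma measurable_otherSamples_iterates (hF : LossRegular P F) {k : ℕ} {q : ℕ × Fin n}
    (hk : k ≤ q.1) : Measurable[otherSamples x₀ ξ q] (iterates F τ W V U α x₀ ξ k) :=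
  hF.measurable_iterates (mΩ := otherSamples x₀ ξ q) (measurable_otherSamples_init q)
    fun l hl i => measurable_otherSamples_sample (p := (l, i)) <|
      ne_of_apply_ne Prod.fst (hl.trans_le hk).ne

lemma measurable_otherSamples_noise (hF : LossRegular P F) (hS : SmoothProblem P F L)
    {p q : ℕ × Fin n} (hpq : p ≠ q) (hle : p.1 ≤ q.1) :
    Measurable[otherSamples x₀ ξ q] (noise P F (iterates F τ W V U α x₀ ξ) ξ p.1 p.2) :=
  (measurable_noiseFun hF hS p.2).comp
    ((measurable_otherSamples_iterates hF hle).prodMk (measurable_otherSamples_sample hpq))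

lemma indep_otherSamples {μ : Measure Ω} [IsZeroOrProbabilityMeasure μ] (hx₀ : Measurable x₀)
    (hξ : ∀ k i, Measurable (ξ k i)) (hindep : iIndepFun (fun p : ℕ × Fin n => ξ p.1 p.2) μ)
    (hindep₀ : IndepFun x₀ (fun ω (p : ℕ × Fin n) => ξ p.1 p.2 ω) μ) (q : ℕ × Fin n) :
    Indep (otherSamples x₀ ξ q) (MeasurableSpace.comap (ξ q.1 q.2) inferInstance) μ := by
  have comap_sample_le (p : ℕ × Fin n) : MeasurableSpace.comap (ξ p.1 p.2) inferInstance ≤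
      MeasurableSpace.comap (fun ω (p : ℕ × Fin n) => ξ p.1 p.2 ω) inferInstance :=
    measurable_iff_comap_le.1 ((measurable_pi_apply (X := fun p : ℕ × Fin n => Ξ p.2) p).comp
      (comap_measurable fun ω (p : ℕ × Fin n) => ξ p.1 p.2 ω))
  refine indep_sup_left_of_indep_sup_right hx₀.comap_le
    (iSup₂_le fun p _ => (hξ p.1 p.2).comap_le) (hξ _ _).comap_le ?_ ?_
  · exact indep_of_indep_of_le_right ((IndepFun_iff_Indep _ _ _).1 hindep₀)
      (sup_le (iSup₂_le fun p _ => comap_sample_le p) (comap_sample_le q))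
  · simpa only [Set.mem_singleton_iff, iSup_iSup_eq_left] using
      indep_iSup_of_disjoint (fun p : ℕ × Fin n => (hξ p.1 p.2).comap_le)
        ((iIndepFun_iff_iIndep _ _ _).1 hindep) (S := {q}ᶜ) (T := {q}) disjoint_compl_left

end Measurability

section Orthogonality

variable {n d : ℕ} {Ξ : Fin n → Type*} [∀ i, MeasurableSpace (Ξ i)]
  {P : ∀ i, Measure (Ξ i)} {F : ∀ i, Vec d → Ξ i → ℝ} {L α σ : ℝ}
  {Ω : Type*} {mΩ : MeasurableSpace Ω} {μ : Measure Ω} [IsProbabilityMeasure μ]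
  {W V U : ℕ → Matrix (Fin n) (Fin n) ℝ} {τ : ℕ}
  {x₀ : Ω → Fin n → Vec d} {ξ : ℕ → ∀ i, Ω → Ξ i}

lemma NoiseAssumption.integral_norm_sq_le {x : ℕ → Ω → Fin n → Vec d}
    (hN : NoiseAssumption μ P F x ξ σ) (hx : ∀ k, Measurable (x k)) (k : ℕ) (i : Fin n) :
    ∫ ω, ‖noise P F x ξ k i ω‖ ^ 2 ∂μ ≤ σ ^ 2 := by
  rw [← integral_condExp (history_le hx k)]
  simpa using integral_mono_ae integrable_condExp (integrable_const (σ ^ 2)) (hN.variance k i)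

lemma NoiseAssumption.integral_inner_eq_zero
    (hN : NoiseAssumption μ P F (iterates F τ W V U α x₀ ξ) ξ σ) (hF : LossRegular P F)
    (hS : SmoothProblem P F L) {q : ℕ × Fin n} {Z : Ω → Vec d}
    (hZ : Measurable[otherSamples x₀ ξ q] Z) (hZ2 : MemLp Z 2 μ) :
    ∫ ω, inner ℝ (Z ω) (noise P F (iterates F τ W V U α x₀ ξ) ξ q.1 q.2 ω) ∂μ = 0 := by
  have hx₀ : Measurable x₀ := hN.measurable_init
  have hξ := hN.measurable_sample
  have indep_of_sample : IndepFun (fun ω => (Z ω, iterates F τ W V U α x₀ ξ q.1 ω))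
      (ξ q.1 q.2) μ := by
    rw [IndepFun_iff_Indep]
    exact indep_of_indep_of_le_left (indep_otherSamples hx₀ hξ hN.indep hN.indep_init q)
      (hZ.prodMk (measurable_otherSamples_iterates hF le_rfl)).comap_le
  exact integral_inner_eq_zero_of_indepFun
    (history_le (x := iterates F τ W V U α x₀ ξ)
      (fun k => hF.measurable_iterates hx₀ fun l _ => hξ l) q.1)
    (φ := noiseFun P F q.2) (hZ.mono (otherSamples_le hx₀ hξ q) le_rfl)
    (measurable_history (iterates F τ W V U α x₀ ξ) q.1) (hξ q.1 q.2)
    (measurable_noiseFun hF hS q.2) indep_of_sample hZ2 (hN.memLp q.1 q.2) (hN.unbiased q.1 q.2)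

lemma NoiseAssumption.pairwise_integral_inner_eq_zero
    (hN : NoiseAssumption μ P F (iterates F τ W V U α x₀ ξ) ξ σ) (hF : LossRegular P F)
    (hS : SmoothProblem P F L) :
    Pairwise fun p q : ℕ × Fin n =>
      ∫ ω, inner ℝ (noise P F (iterates F τ W V U α x₀ ξ) ξ p.1 p.2 ω)
        (noise P F (iterates F τ W V U α x₀ ξ) ξ q.1 q.2 ω) ∂μ = 0 := by
  intro p q hpq
  rcases le_total p.1 q.1 with hle | hle
  · exact hN.integral_inner_eq_zero hF hS (measurable_otherSamples_noise hF hS hpq hle)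
      (hN.memLp _ _)
  · simp_rw [real_inner_comm (noise _ _ _ _ q.1 q.2 _)]
    exact hN.integral_inner_eq_zero hF hS (measurable_otherSamples_noise hF hS hpq.symm hle)
      (hN.memLp _ _)

end Orthogonality

/-! ### Mean-square bounds along the iterates -/

section StackedMemLp

variable {n d : ℕ} {Ω : Type*} {mΩ : MeasurableSpace Ω} {μ : Measure Ω}

lemma integrable_sqNorm {v : Ω → Fin n → Vec d} (hv : MemLp v 2 μ) :
    Integrable (fun ω => sqNorm (v ω)) μ :=
  integrable_finsetSum _ fun i _ => (hv.eval i).integrable_norm_pow two_ne_zero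

/-- Centered gradient noise of the `n` agents, abstracted from the samples that generate it: the
noise `N k ω i` of agent `i` at iteration `k` is square-integrable with second moment at most `σ²`,
and noises of distinct agents or iterations are orthogonal. -/
structure OrthogonalNoise (μ : Measure Ω) (N : ℕ → Ω → Fin n → Vec d) (σ : ℝ) : Prop where
  memLp : ∀ k, MemLp (N k) 2 μ
  orthogonal : Pairwise fun p q : ℕ × Fin n =>
    ∫ ω, inner ℝ (N p.1 ω p.2) (N q.1 ω q.2) ∂μ = 0
  variance : ∀ k i, ∫ ω, ‖N k ω i‖ ^ 2 ∂μ ≤ σ ^ 2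

namespace OrthogonalNoise

variable {N : ℕ → Ω → Fin n → Vec d} {σ : ℝ} (h : OrthogonalNoise μ N σ)

include h

lemma memLp_avg (k : ℕ) : MemLp (fun ω => avg (N k ω)) 2 μ :=
  memLp_comp_of_isLinearMap isLinearMap_avg (h.memLp k)

lemma integral_norm_avg_sq_le (k : ℕ) : ∫ ω, ‖avg (N k ω)‖ ^ 2 ∂μ ≤ σ ^ 2 / n := by
  calc ∫ ω, ‖avg (N k ω)‖ ^ 2 ∂μ
      = ∫ ω, ‖∑ i, (n : ℝ)⁻¹ • N k ω i‖ ^ 2 ∂μ := by simp only [avg, Finset.smul_sum]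
    _ ≤ (∑ _ : Fin n, (n : ℝ)⁻¹ ^ 2) * σ ^ 2 :=
        integral_norm_sum_smul_sq_le (fun i => (h.memLp k).eval i)
          (fun i j hij => @h.orthogonal (k, i) (k, j) fun hkij => hij (Prod.ext_iff.1 hkij).2)
          (h.variance k) Finset.univ _
    _ = σ ^ 2 / n := by
        rcases eq_or_ne (n : ℝ) 0 with hn | hn
        · simp [hn]
        · simp only [Finset.sum_const, Finset.card_univ, Fintype.card_fin, nsmul_eq_mul]
          field_simp

variable {A : ℕ → Matrix (Fin n) (Fin n) ℝ}

lemma memLp_sum_smul_mix (A : ℕ → Matrix (Fin n) (Fin n) ℝ) (c : ℕ → ℝ) (p r : ℕ) :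
    MemLp (fun ω => ∑ q ∈ Finset.range p, c q • mix (A q) (N (r + q) ω)) 2 μ :=
  memLp_finsetSum _ fun q _ =>
    (memLp_comp_of_isLinearMap (isLinearMap_mix (A q)) (h.memLp (r + q))).const_smul (c q)

lemma integral_norm_sum_smul_mix_sq_le (hA : ∀ q, A q ∈ doublyStochastic ℝ (Fin n)) (c : ℕ → ℝ)
    (p r : ℕ) (i : Fin n) :
    ∫ ω, ‖(∑ q ∈ Finset.range p, c q • mix (A q) (N (r + q) ω)) i‖ ^ 2 ∂μ
      ≤ (∑ q ∈ Finset.range p, c q ^ 2) * σ ^ 2 := by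
  have sum_row_sq_le (q : ℕ) : ∑ j, A q i j ^ 2 ≤ 1 := by
    rw [← sum_row_of_mem_doublyStochastic (hA q) i]
    gcongr with j
    exact pow_le_of_le_one (nonneg_of_mem_doublyStochastic (hA q))
      (le_one_of_mem_doublyStochastic (hA q)) two_ne_zero
  calc ∫ ω, ‖(∑ q ∈ Finset.range p, c q • mix (A q) (N (r + q) ω)) i‖ ^ 2 ∂μ
      = ∫ ω, ‖∑ z ∈ Finset.range p ×ˢ Finset.univ,
          (c z.1 * A z.1 i z.2) • N (r + z.1) ω z.2‖ ^ 2 ∂μ := by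
        simp only [Finset.sum_product, Finset.sum_apply, Pi.smul_apply, mix, Finset.smul_sum,
          smul_smul]
    _ ≤ (∑ z ∈ Finset.range p ×ˢ Finset.univ, (c z.1 * A z.1 i z.2) ^ 2) * σ ^ 2 :=
        integral_norm_sum_smul_sq_le (N := fun (z : ℕ × Fin n) ω => N (r + z.1) ω z.2)
          (fun z => (h.memLp _).eval _)
          (fun z w hzw => @h.orthogonal (r + z.1, z.2) (r + w.1, w.2) fun heq =>
            hzw <| by simpa [Prod.ext_iff] using heq)
          (fun z => h.variance _ _) _ _
    _ ≤ (∑ q ∈ Finset.range p, c q ^ 2) * σ ^ 2 := by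
        simp only [Finset.sum_product, mul_pow, ← Finset.mul_sum]
        gcongr with q
        exact mul_le_of_le_one_right (sq_nonneg _) (sum_row_sq_le q)

lemma integral_sqNorm_sum_smul_mix_le (hA : ∀ q, A q ∈ doublyStochastic ℝ (Fin n)) (c : ℕ → ℝ)
    (p r : ℕ) :
    ∫ ω, sqNorm (∑ q ∈ Finset.range p, c q • mix (A q) (N (r + q) ω)) ∂μ
      ≤ (∑ q ∈ Finset.range p, c q ^ 2) * (n * σ ^ 2) := by
  simp only [sqNorm]
  rw [integral_finsetSum _ fun i _ =>
    ((h.memLp_sum_smul_mix A c p r).eval i).integrable_norm_pow two_ne_zero]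
  refine (Finset.sum_le_sum fun i _ => h.integral_norm_sum_smul_mix_sq_le hA c p r i).trans_eq ?_
  simp only [Finset.sum_const, Finset.card_univ, Fintype.card_fin, nsmul_eq_mul]
  ring

lemma integral_sqNorm_sum_lag_smul_mix_le (hA : ∀ q, A q ∈ doublyStochastic ℝ (Fin n))
    (τ p r : ℕ) :
    ∫ ω, sqNorm (∑ q ∈ Finset.range p, lag τ (p - q) • mix (A q) (N (r + q) ω)) ∂μ
      ≤ 4 * (τ : ℝ) ^ 3 * (n * σ ^ 2) :=
  (h.integral_sqNorm_sum_smul_mix_le hA (fun q => lag τ (p - q)) p r).trans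
    (mul_le_mul_of_nonneg_right (sum_lag_sq_le τ p) (by positivity))

end OrthogonalNoise

end StackedMemLp

section TrackedRun

variable {n d : ℕ} {Ξ : Fin n → Type*} [∀ i, MeasurableSpace (Ξ i)]
  {Ω : Type*} {mΩ : MeasurableSpace Ω}

/-- What the convergence analysis uses about random iterates `x` and gradient noises `N` of gradient
tracking with step size `α`, when all agents agree during a warm-up period of length `t + 1`
(written as a successor so that the iteration `t` needs no truncated subtraction). -/
structure TrackedRun (μ : Measure Ω) (P : ∀ i, Measure (Ξ i)) (F : ∀ i, Vec d → Ξ i → ℝ)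
    (x N : ℕ → Ω → Fin n → Vec d) (α σ : ℝ) (t : ℕ) : Prop where
  measurable : ∀ k, Measurable (x k)
  integrable_init : Integrable (fun ω => obj P F (avg (x 0 ω))) μ
  noise : OrthogonalNoise μ N σ
  orthogonal_state : ∀ k i (ψ : (Fin n → Vec d) → Vec d), Measurable ψ →
    MemLp (fun ω => ψ (x k ω)) 2 μ → ∫ ω, inner ℝ (ψ (x k ω)) (N k ω i) ∂μ = 0
  avg_succ : ∀ k ω, avg (x (k + 1) ω) =
    avg (x k ω) - α • (avg (trueGrad P F (x k ω)) + avg (N k ω))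
  consensual : ∀ k ≤ t + 1, ∀ᵐ ω ∂μ, deviation (x k ω) = 0
  deviation_eq : ∀ p, ∃ M : ℕ → Matrix (Fin n) (Fin n) ℝ,
    (∀ q, M q ∈ doublyStochastic ℝ (Fin n)) ∧
    ∀ᵐ ω ∂μ, deviation (x (t + 1 + p) ω) = -α • deviation (∑ q ∈ Finset.range p,
      lag (t + 1) (p - q) • mix (M q) ((trueGrad P F (x (t + 1 + q) ω) + N (t + 1 + q) ω)
        - (trueGrad P F (x (t + q) ω) + N (t + q) ω)))

variable {μ : Measure Ω} {P : ∀ i, Measure (Ξ i)} {F : ∀ i, Vec d → Ξ i → ℝ} {L : ℝ}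

lemma SmoothProblem.memLp_trueGrad_sub (hS : SmoothProblem P F L) {u v : Ω → Fin n → Vec d}
    (hu : Measurable u) (hv : Measurable v) (huv : MemLp (fun ω => u ω - v ω) 2 μ) :
    MemLp (fun ω => trueGrad P F (u ω) - trueGrad P F (v ω)) 2 μ :=
  huv.of_le_mul (c := L) ((hS.continuous_trueGrad.measurable.comp hu).sub
    (hS.continuous_trueGrad.measurable.comp hv)).aestronglyMeasurable
    (ae_of_all _ fun _ => hS.norm_trueGrad_sub_le _ _)

lemma SmoothProblem.memLp_avg_trueGrad (hS : SmoothProblem P F L) {u : Ω → Fin n → Vec d}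
    (hu : Measurable u) (hdev : MemLp (fun ω => deviation (u ω)) 2 μ)
    (hgrad : MemLp (fun ω => gradient (obj P F) (avg (u ω))) 2 μ) :
    MemLp (fun ω => avg (trueGrad P F (u ω))) 2 μ := by
  have memLp_sub := memLp_comp_of_isLinearMap isLinearMap_avg <|
    hS.memLp_trueGrad_sub (v := fun ω _ => avg (u ω)) hu
      (measurable_pi_lambda _ fun _ => measurable_avg.comp hu) hdev
  simp_rw [isLinearMap_avg.map_sub, ← hS.gradient_obj] at memLp_sub
  simpa [Pi.add_def] using memLp_sub.add hgrad

namespace TrackedRun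

variable {x N : ℕ → Ω → Fin n → Vec d} {α σ : ℝ} {t : ℕ}
  (h : TrackedRun μ P F x N α σ t) (hS : SmoothProblem P F L)

include h

lemma measurable_avg_comp (k : ℕ) : Measurable fun ω => avg (x k ω) :=
  measurable_avg.comp (h.measurable k)

lemma avg_sub_avg (k : ℕ) (ω : Ω) :
    avg (x (k + 1) ω) - avg (x k ω) = -α • (avg (trueGrad P F (x k ω)) + avg (N k ω)) := by
  rw [h.avg_succ, neg_smul]; abel

lemma integral_inner_avg_noise_eq_zero (k : ℕ) {ψ : (Fin n → Vec d) → Vec d} (hψ : Measurable ψ)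
    (hψ2 : MemLp (fun ω => ψ (x k ω)) 2 μ) :
    ∫ ω, inner ℝ (ψ (x k ω)) (avg (N k ω)) ∂μ = 0 := by
  simp only [avg, inner_smul_right, inner_sum]
  rw [integral_const_mul, integral_finsetSum _ fun i _ =>
    integrable_inner_of_memLp hψ2 ((h.noise.memLp k).eval i)]
  simp only [h.orthogonal_state k _ ψ hψ hψ2, Finset.sum_const_zero, mul_zero]

lemma integral_sqNorm_deviation_eq_zero {k : ℕ} (hk : k ≤ t + 1) :
    ∫ ω, sqNorm (deviation (x k ω)) ∂μ = 0 := by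
  rw [integral_congr_ae ((h.consensual k hk).mono fun ω hω => congrArg sqNorm hω)]
  simp [sqNorm]

section Integrability

include hS

lemma memLp_avg_sub_of_memLp {k : ℕ} (hdev : MemLp (fun ω => deviation (x k ω)) 2 μ)
    (hgrad : MemLp (fun ω => gradient (obj P F) (avg (x k ω))) 2 μ) :
    MemLp (fun ω => avg (x (k + 1) ω) - avg (x k ω)) 2 μ := by
  simp_rw [h.avg_sub_avg]
  exact ((hS.memLp_avg_trueGrad (h.measurable k) hdev hgrad).add
    (h.noise.memLp_avg k)).const_smul (-α)

lemma memLp_sub_of_memLp {k : ℕ} (hdev : MemLp (fun ω => deviation (x k ω)) 2 μ)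
    (hdev' : MemLp (fun ω => deviation (x (k + 1) ω)) 2 μ)
    (hgrad : MemLp (fun ω => gradient (obj P F) (avg (x k ω))) 2 μ) :
    MemLp (fun ω => x (k + 1) ω - x k ω) 2 μ := by
  have decompose (u v : Fin n → Vec d) :
      u - v = (deviation u - deviation v) + fun _ => avg u - avg v := by
    ext1 i; simp only [deviation, Pi.sub_apply, Pi.add_apply]; abel
  simp_rw [decompose (x (k + 1) _)]
  exact (hdev'.sub hdev).add (.of_eval fun _ => h.memLp_avg_sub_of_memLp hS hdev hgrad)

lemma memLp_gradient_zero [IsFiniteMeasure μ] :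
    MemLp (fun ω => gradient (obj P F) (avg (x 0 ω))) 2 μ := by
  have hmeas : Measurable fun ω => gradient (obj P F) (avg (x 0 ω)) :=
    hS.continuous_gradient_obj.measurable.comp (h.measurable_avg_comp 0)
  rw [memLp_two_iff_integrable_sq_norm hmeas.aestronglyMeasurable]
  refine ((h.integrable_init.sub (integrable_const (optVal P F))).const_mul (2 * L)).mono'
    (hmeas.norm.pow_const 2).aestronglyMeasurable (ae_of_all _ fun ω => ?_)
  rw [Real.norm_of_nonneg (sq_nonneg _)]
  exact hS.norm_gradient_obj_sq_le _

lemma memLp_gradient_succ_of_memLp {k : ℕ} (hdev : MemLp (fun ω => deviation (x k ω)) 2 μ)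
    (hgrad : MemLp (fun ω => gradient (obj P F) (avg (x k ω))) 2 μ) :
    MemLp (fun ω => gradient (obj P F) (avg (x (k + 1) ω))) 2 μ := by
  have hmeas (k : ℕ) := hS.continuous_gradient_obj.measurable.comp (h.measurable_avg_comp k)
  have memLp_sub : MemLp (fun ω => gradient (obj P F) (avg (x (k + 1) ω))
      - gradient (obj P F) (avg (x k ω))) 2 μ :=
    (h.memLp_avg_sub_of_memLp hS hdev hgrad).of_le_mul (c := L)
      ((hmeas _).sub (hmeas _)).aestronglyMeasurable (ae_of_all _ fun _ => hS.lipschitz_obj _ _)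
  simpa [Pi.add_def] using memLp_sub.add hgrad

lemma memLp_deviation_of_memLp_sub {k : ℕ}
    (hsub : ∀ j, j + 1 < k → MemLp (fun ω => x (j + 1) ω - x j ω) 2 μ) :
    MemLp (fun ω => deviation (x k ω)) 2 μ := by
  rcases le_total k (t + 1) with hk | hk
  · exact (memLp_congr_ae (h.consensual k hk)).2 .zero
  · obtain ⟨p, rfl⟩ := Nat.exists_eq_add_of_le hk
    obtain ⟨M, -, hM⟩ := h.deviation_eq p
    have memLp_increment (q : ℕ) (hq : q ∈ Finset.range p) :
        MemLp (fun ω => (trueGrad P F (x (t + 1 + q) ω) + N (t + 1 + q) ω)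
          - (trueGrad P F (x (t + q) ω) + N (t + q) ω)) 2 μ := by
      simp_rw [add_sub_add_comm, add_right_comm t 1]
      have := Finset.mem_range.1 hq
      exact (hS.memLp_trueGrad_sub (h.measurable _) (h.measurable _)
        (hsub (t + q) (by omega))).add ((h.noise.memLp _).sub (h.noise.memLp _))
    have memLp_sum := memLp_finsetSum (Finset.range p) fun q hq =>
      (memLp_comp_of_isLinearMap (isLinearMap_mix (M q)) (memLp_increment q hq)).const_smul
        (lag (t + 1) (p - q))
    exact (memLp_congr_ae hM).2
      ((memLp_comp_of_isLinearMap isLinearMap_deviation memLp_sum).const_smul (-α))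

variable [IsFiniteMeasure μ]

lemma memLp_deviation_and_memLp_gradient (k : ℕ) :
    MemLp (fun ω => deviation (x k ω)) 2 μ ∧
      MemLp (fun ω => gradient (obj P F) (avg (x k ω))) 2 μ := by
  induction k using Nat.strong_induction_on with
  | _ k ih =>
    constructor
    · exact h.memLp_deviation_of_memLp_sub hS fun j hj =>
        h.memLp_sub_of_memLp hS (ih j (by omega)).1 (ih (j + 1) hj).1 (ih j (by omega)).2
    · rcases k with _ | k
      · exact h.memLp_gradient_zero hS
      · exact h.memLp_gradient_succ_of_memLp hS (ih k k.lt_succ_self).1 (ih k k.lt_succ_self).2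

lemma memLp_deviation (k : ℕ) : MemLp (fun ω => deviation (x k ω)) 2 μ :=
  (h.memLp_deviation_and_memLp_gradient hS k).1

lemma memLp_gradient (k : ℕ) : MemLp (fun ω => gradient (obj P F) (avg (x k ω))) 2 μ :=
  (h.memLp_deviation_and_memLp_gradient hS k).2

lemma memLp_avg_trueGrad (k : ℕ) : MemLp (fun ω => avg (trueGrad P F (x k ω))) 2 μ :=
  hS.memLp_avg_trueGrad (h.measurable k) (h.memLp_deviation hS k) (h.memLp_gradient hS k)

lemma memLp_sub (k : ℕ) : MemLp (fun ω => x (k + 1) ω - x k ω) 2 μ :=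
  h.memLp_sub_of_memLp hS (h.memLp_deviation hS k) (h.memLp_deviation hS _) (h.memLp_gradient hS k)

lemma integrable_obj (k : ℕ) : Integrable (fun ω => obj P F (avg (x k ω))) μ := by
  induction k with
  | zero => exact h.integrable_init
  | succ k ih =>
    have hgrad := h.memLp_gradient hS k
    have hsub := h.memLp_avg_sub_of_memLp hS (h.memLp_deviation hS k) hgrad
    have quadratic_upper_bound (ω : Ω) := apply_add_le_of_lipschitz_gradient hS.differentiable_obj
      hS.lipschitz_obj (avg (x k ω)) (avg (x (k + 1) ω) - avg (x k ω))
    simp_rw [add_sub_cancel] at quadratic_upper_bound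
    exact integrable_of_le_of_le (hS.differentiable_obj.continuous.measurable.comp
        (h.measurable_avg_comp _)).aestronglyMeasurable
      (ae_of_all _ fun ω => hS.optVal_le _) (ae_of_all _ quadratic_upper_bound)
      (integrable_const _) ((ih.add (integrable_inner_of_memLp hgrad hsub)).add
        ((hsub.integrable_norm_pow two_ne_zero).const_mul (L / 2)))

end Integrability

end TrackedRun

end TrackedRun

section MeanSquareRecursion

variable {n d : ℕ} {Ξ : Fin n → Type*} [∀ i, MeasurableSpace (Ξ i)]
  {Ω : Type*} {mΩ : MeasurableSpace Ω} {μ : Measure Ω} {P : ∀ i, Measure (Ξ i)}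
  {F : ∀ i, Vec d → Ξ i → ℝ} {L : ℝ} {x N : ℕ → Ω → Fin n → Vec d} {α σ : ℝ} {t : ℕ}

lemma SmoothProblem.sqNorm_deviation_sum_lag_le (hS : SmoothProblem P F L)
    {M : ℕ → Matrix (Fin n) (Fin n) ℝ} (hM : ∀ q, M q ∈ doublyStochastic ℝ (Fin n)) (t p : ℕ)
    (y e : ℕ → Fin n → Vec d) :
    sqNorm (deviation (∑ q ∈ Finset.range p, lag (t + 1) (p - q) • mix (M q)
      ((trueGrad P F (y (t + 1 + q)) + e (t + 1 + q)) - (trueGrad P F (y (t + q)) + e (t + q)))))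
    ≤ 4 * ((t + 1 : ℕ) : ℝ) ^ 2 * L ^ 2 *
        ∑ q ∈ Finset.range p, lag (t + 1) (p - q) * sqNorm (y (t + q + 1) - y (t + q))
      + (4 * sqNorm (∑ q ∈ Finset.range p, lag (t + 1) (p - q) • mix (M q) (e (t + 1 + q)))
        + 4 * sqNorm (∑ q ∈ Finset.range p, lag (t + 1) (p - q) • mix (M q) (e (t + q)))) := by
  set G := ∑ q ∈ Finset.range p, lag (t + 1) (p - q) •
    mix (M q) (trueGrad P F (y (t + q + 1)) - trueGrad P F (y (t + q)))
  set S := ∑ q ∈ Finset.range p, lag (t + 1) (p - q) • mix (M q) (e (t + 1 + q))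
  set S' := ∑ q ∈ Finset.range p, lag (t + 1) (p - q) • mix (M q) (e (t + q))
  have sqNorm_G_le : sqNorm G ≤ 2 * ((t + 1 : ℕ) : ℝ) ^ 2 * (L ^ 2 *
      ∑ q ∈ Finset.range p, lag (t + 1) (p - q) * sqNorm (y (t + q + 1) - y (t + q))) := by
    refine (sqNorm_sum_smul_le (fun q _ => lag_nonneg _ _) _).trans ?_
    simp_rw [Finset.mul_sum _ _ (L ^ 2), mul_left_comm (L ^ 2)]
    gcongr with q
    · exact Finset.sum_nonneg fun q _ => mul_nonneg (lag_nonneg _ _) (sqNorm_nonneg _)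
    · exact sum_lag_sub_left_le _ _
    · exact lag_nonneg _ _
    · exact (sqNorm_mix_le (hM q) _).trans (hS.sqNorm_trueGrad_sub_le _ _)
  calc sqNorm (deviation _) ≤ sqNorm (G + (S - S')) := by
        refine (sqNorm_deviation_le _).trans_eq (congrArg sqNorm ?_)
        simp only [G, S, S', ← Finset.sum_sub_distrib, ← Finset.sum_add_distrib, ← smul_sub,
          ← smul_add, ← (isLinearMap_mix _).map_sub, ← (isLinearMap_mix _).map_add,
          add_right_comm t 1, add_sub_add_comm]
    _ ≤ 2 * (sqNorm G + 2 * (sqNorm S + sqNorm S')) :=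
        (sqNorm_add_le _ _).trans (by gcongr; exact sqNorm_sub_le _ _)
    _ ≤ _ := by linarith

namespace TrackedRun

lemma obj_avg_succ_le (h : TrackedRun μ P F x N α σ t) (hS : SmoothProblem P F L) (hα : 0 ≤ α)
    (hαL : L * α ≤ 1 / 2) (k : ℕ) (ω : Ω) :
    obj P F (avg (x (k + 1) ω)) ≤ obj P F (avg (x k ω))
      - α / 2 * ‖gradient (obj P F) (avg (x k ω))‖ ^ 2
      - α / 4 * ‖avg (trueGrad P F (x k ω))‖ ^ 2
      + α * L ^ 2 / (2 * n) * sqNorm (deviation (x k ω)) + L * α ^ 2 / 2 * ‖avg (N k ω)‖ ^ 2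
      + inner ℝ ((L * α ^ 2) • avg (trueGrad P F (x k ω))
        - α • gradient (obj P F) (avg (x k ω))) (avg (N k ω)) := by
  have descent := apply_sub_smul_le_of_lipschitz_gradient hS.differentiable_obj hS.lipschitz_obj α
    (avg (x k ω)) (avg (trueGrad P F (x k ω))) (avg (N k ω))
  have gradient_error := mul_le_mul_of_nonneg_left
    (hS.norm_avg_trueGrad_sub_gradient_sq_le (x k ω)) (div_nonneg hα zero_le_two)
  rw [show α / 2 * ((n : ℝ)⁻¹ * (L ^ 2 * sqNorm (deviation (x k ω))))
    = α * L ^ 2 / (2 * n) * sqNorm (deviation (x k ω)) by ring] at gradient_error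
  have step_small := mul_le_mul_of_nonneg_right (show α / 4 ≤ α / 2 * (1 - L * α) by nlinarith)
    (sq_nonneg ‖avg (trueGrad P F (x k ω))‖)
  rw [h.avg_succ, inner_sub_left, real_inner_smul_left, real_inner_smul_left]
  linarith

variable [IsFiniteMeasure μ]

lemma integral_obj_avg_succ_le (h : TrackedRun μ P F x N α σ t) (hS : SmoothProblem P F L)
    (hα : 0 ≤ α) (hαL : L * α ≤ 1 / 2) (k : ℕ) :
    ∫ ω, obj P F (avg (x (k + 1) ω)) ∂μ ≤ ∫ ω, obj P F (avg (x k ω)) ∂μ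
      - α / 2 * ∫ ω, ‖gradient (obj P F) (avg (x k ω))‖ ^ 2 ∂μ
      - α / 4 * ∫ ω, ‖avg (trueGrad P F (x k ω))‖ ^ 2 ∂μ
      + α * L ^ 2 / (2 * n) * ∫ ω, sqNorm (deviation (x k ω)) ∂μ
      + L * α ^ 2 / 2 * (σ ^ 2 / n) := by
  have hgrad := h.memLp_gradient hS k
  have havg := h.memLp_avg_trueGrad hS k
  have hnoise := h.noise.memLp_avg k
  have hcombined : MemLp (fun ω => (L * α ^ 2) • avg (trueGrad P F (x k ω))
      - α • gradient (obj P F) (avg (x k ω))) 2 μ :=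
    (havg.const_smul (L * α ^ 2)).sub (hgrad.const_smul α)
  have integrable_obj := h.integrable_obj hS
  have integrable_gradient := hgrad.integrable_norm_pow two_ne_zero
  have integrable_avg := havg.integrable_norm_pow two_ne_zero
  have integrable_deviation := integrable_sqNorm (h.memLp_deviation hS k)
  have integrable_noise := hnoise.integrable_norm_pow two_ne_zero
  have integrable_inner := integrable_inner_of_memLp hcombined hnoise
  have expected_descent := integral_mono (integrable_obj (k + 1)) (by fun_prop)
    (h.obj_avg_succ_le hS hα hαL k)
  rw [integral_add (by fun_prop) integrable_inner, integral_add (by fun_prop) (by fun_prop),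
    integral_add (by fun_prop) (by fun_prop), integral_sub (by fun_prop) (by fun_prop),
    integral_sub (by fun_prop) (by fun_prop),
    h.integral_inner_avg_noise_eq_zero (ψ := fun v => (L * α ^ 2) • avg (trueGrad P F v)
      - α • gradient (obj P F) (avg v)) k
      (((measurable_avg.comp hS.continuous_trueGrad.measurable).const_smul (L * α ^ 2)).sub
        ((hS.continuous_gradient_obj.measurable.comp measurable_avg).const_smul α)) hcombined]
    at expected_descent
  simp only [integral_const_mul] at expected_descent
  have noise_le := mul_le_mul_of_nonneg_left (h.noise.integral_norm_avg_sq_le k)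
    (div_nonneg (mul_nonneg hS.pos.le (sq_nonneg α)) zero_le_two)
  linarith

lemma integral_norm_avg_sub_sq (h : TrackedRun μ P F x N α σ t) (hS : SmoothProblem P F L)
    (k : ℕ) :
    ∫ ω, ‖avg (x (k + 1) ω) - avg (x k ω)‖ ^ 2 ∂μ =
      α ^ 2 * (∫ ω, ‖avg (trueGrad P F (x k ω))‖ ^ 2 ∂μ + ∫ ω, ‖avg (N k ω)‖ ^ 2 ∂μ) := by
  have havg := h.memLp_avg_trueGrad hS k
  rw [← integral_norm_add_sq_of_integral_inner_eq_zero havg (h.noise.memLp_avg k)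
    (h.integral_inner_avg_noise_eq_zero (ψ := fun v => avg (trueGrad P F v)) k
      (measurable_avg.comp hS.continuous_trueGrad.measurable) havg), ← integral_const_mul]
  simp only [h.avg_sub_avg, norm_smul, mul_pow, norm_neg, Real.norm_eq_abs, sq_abs]

lemma integral_sqNorm_sub_le (h : TrackedRun μ P F x N α σ t) (hS : SmoothProblem P F L) (k : ℕ) :
    ∫ ω, sqNorm (x (k + 1) ω - x k ω) ∂μ ≤
      2 * ∫ ω, sqNorm (deviation (x (k + 1) ω)) ∂μ + 2 * ∫ ω, sqNorm (deviation (x k ω)) ∂μ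
      + n * α ^ 2 * ∫ ω, ‖avg (trueGrad P F (x k ω))‖ ^ 2 ∂μ + α ^ 2 * σ ^ 2 := by
  have integrable_deviation (k : ℕ) := integrable_sqNorm (h.memLp_deviation hS k)
  have memLp_avg_sub := h.memLp_avg_sub_of_memLp hS (h.memLp_deviation hS k)
    (h.memLp_gradient hS k)
  have integrable_avg_sub := memLp_avg_sub.integrable_norm_pow two_ne_zero
  have pointwise_bound (ω : Ω) : sqNorm (x (k + 1) ω - x k ω) ≤
      2 * sqNorm (deviation (x (k + 1) ω)) + 2 * sqNorm (deviation (x k ω))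
        + n * ‖avg (x (k + 1) ω) - avg (x k ω)‖ ^ 2 := by
    rw [sqNorm_eq_deviation_add, isLinearMap_deviation.map_sub, isLinearMap_avg.map_sub, ← mul_add]
    gcongr
    exact sqNorm_sub_le _ _
  have integral_le := integral_mono (integrable_sqNorm (h.memLp_sub hS k)) (by fun_prop)
    pointwise_bound
  rw [integral_add (by fun_prop) (by fun_prop), integral_add (by fun_prop) (by fun_prop)]
    at integral_le
  simp only [integral_const_mul, h.integral_norm_avg_sub_sq hS] at integral_le
  have noise_le : (∫ ω, ‖avg (N k ω)‖ ^ 2 ∂μ) * n ≤ σ ^ 2 :=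
    mul_le_of_le_div₀ (sq_nonneg σ) n.cast_nonneg (h.noise.integral_norm_avg_sq_le k)
  have := mul_le_mul_of_nonneg_left noise_le (sq_nonneg α)
  linarith

lemma integral_sqNorm_deviation_le (h : TrackedRun μ P F x N α σ t) (hS : SmoothProblem P F L)
    (p : ℕ) :
    ∫ ω, sqNorm (deviation (x (t + 1 + p) ω)) ∂μ ≤ α ^ 2 * (4 * ((t + 1 : ℕ) : ℝ) ^ 2 * L ^ 2 *
      ∑ q ∈ Finset.range p, lag (t + 1) (p - q) *
        ∫ ω, sqNorm (x (t + q + 1) ω - x (t + q) ω) ∂μ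
      + 32 * ((t + 1 : ℕ) : ℝ) ^ 3 * n * σ ^ 2) := by
  obtain ⟨M, hM, deviation_eq⟩ := h.deviation_eq p
  let S (r : ℕ) (ω : Ω) := ∑ q ∈ Finset.range p, lag (t + 1) (p - q) • mix (M q) (N (r + q) ω)
  have integrable_S (r : ℕ) : Integrable (fun ω => sqNorm (S r ω)) μ :=
    integrable_sqNorm (h.noise.memLp_sum_smul_mix M (fun q => lag (t + 1) (p - q)) p r)
  have integral_S_le (r : ℕ) := h.noise.integral_sqNorm_sum_lag_smul_mix_le hM (t + 1) p r
  have integrable_sub (q : ℕ) : Integrable (fun ω =>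
      lag (t + 1) (p - q) * sqNorm (x (t + q + 1) ω - x (t + q) ω)) μ :=
    (integrable_sqNorm (h.memLp_sub hS _)).const_mul _
  have integrable_sum_sub := (integrable_finsetSum (Finset.range p) fun q _ =>
    integrable_sub q).const_mul (4 * ((t + 1 : ℕ) : ℝ) ^ 2 * L ^ 2)
  have integrable_noise : Integrable (fun ω =>
      4 * sqNorm (S (t + 1) ω) + 4 * sqNorm (S t ω)) μ :=
    ((integrable_S (t + 1)).const_mul 4).add ((integrable_S t).const_mul 4)
  have pointwise_bound : ∀ᵐ ω ∂μ, sqNorm (deviation (x (t + 1 + p) ω)) ≤ α ^ 2 *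
      (4 * ((t + 1 : ℕ) : ℝ) ^ 2 * L ^ 2 * ∑ q ∈ Finset.range p,
        lag (t + 1) (p - q) * sqNorm (x (t + q + 1) ω - x (t + q) ω)
      + (4 * sqNorm (S (t + 1) ω) + 4 * sqNorm (S t ω))) := by
    filter_upwards [deviation_eq] with ω hω
    rw [hω, sqNorm_smul, neg_sq]
    exact mul_le_mul_of_nonneg_left (hS.sqNorm_deviation_sum_lag_le hM t p (fun k => x k ω)
      fun k => N k ω) (sq_nonneg α)
  refine (integral_mono_ae (integrable_sqNorm (h.memLp_deviation hS (t + 1 + p)))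
    ((integrable_sum_sub.add integrable_noise).const_mul (α ^ 2)) pointwise_bound).trans ?_
  simp only [Pi.add_apply]
  rw [integral_const_mul, integral_add integrable_sum_sub integrable_noise,
    integral_add ((integrable_S _).const_mul 4) ((integrable_S _).const_mul 4), integral_const_mul,
    integral_finsetSum _ fun q _ => integrable_sub q]
  simp only [integral_const_mul]
  gcongr
  linarith [integral_S_le (t + 1), integral_S_le t]

end TrackedRun

end MeanSquareRecursion

/-! ### Solving the recursions -/

section Recursion

variable {A D X : ℕ → ℝ} {a b c e : ℝ}

lemma sum_range_add_le (hX : ∀ k, 0 ≤ X k) {r m K : ℕ} (h : r + m ≤ K) :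
    ∑ q ∈ Finset.range m, X (r + q) ≤ ∑ k ∈ Finset.range K, X k :=
  calc ∑ q ∈ Finset.range m, X (r + q)
      ≤ ∑ k ∈ Finset.range (r + m), X k := by
        rw [Finset.sum_range_add]
        exact le_add_of_nonneg_left (Finset.sum_nonneg fun k _ => hX k)
    _ ≤ ∑ k ∈ Finset.range K, X k :=
        Finset.sum_le_sum_of_subset_of_nonneg (Finset.range_subset_range.2 h) fun k _ _ => hX k

lemma sum_le_of_lag_recursion (hX : ∀ k, 0 ≤ X k) (ha : 0 ≤ a) {τ : ℕ}
    (hD_zero : ∀ k < τ, D k = 0)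
    (hD_le : ∀ p, D (τ + p) ≤ a * ∑ q ∈ Finset.range p, lag τ (p - q) * X q + b) (R : ℕ) :
    ∑ k ∈ Finset.range (τ + R + 1), D k ≤
      a * (2 * (τ : ℝ) ^ 2 * ∑ q ∈ Finset.range R, X q) + (R + 1 : ℕ) * b := by
  rw [add_assoc, Finset.sum_range_add,
    Finset.sum_eq_zero fun k hk => hD_zero k (Finset.mem_range.1 hk), zero_add]
  refine (Finset.sum_le_sum fun p _ => hD_le p).trans ?_
  rw [Finset.sum_add_distrib, ← Finset.mul_sum, Finset.sum_const, Finset.card_range, nsmul_eq_mul]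
  gcongr
  exact sum_sum_lag_mul_le τ R hX

lemma sum_le_of_coupled_recursion (hA : ∀ k, 0 ≤ A k) (hD : ∀ k, 0 ≤ D k) (hX : ∀ k, 0 ≤ X k)
    (ha : 0 ≤ a) (hb : 0 ≤ b) (hc : 0 ≤ c) (he : 0 ≤ e) {t : ℕ}
    (hD_zero : ∀ k < t + 1, D k = 0)
    (hD_le : ∀ p, D (t + 1 + p) ≤
      a * ∑ q ∈ Finset.range p, lag (t + 1) (p - q) * X (t + q) + b)
    (hX_le : ∀ k, X k ≤ 2 * D (k + 1) + 2 * D k + c * A k + e)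
    (hsmall : a * ((t + 1 : ℕ) : ℝ) ^ 2 ≤ 1 / 12) (R : ℕ) :
    ∑ k ∈ Finset.range (t + 1 + R + 1), D k ≤
      c / 2 * ∑ k ∈ Finset.range (t + 1 + R + 1), A k
        + (t + 1 + R + 1 : ℕ) * (e / 2 + 3 * b) := by
  set K := t + 1 + R + 1
  have sum_D_le := sum_le_of_lag_recursion (fun k => hX (t + k)) ha hD_zero hD_le R
  have sum_X_le : ∑ q ∈ Finset.range R, X (t + q) ≤ 4 * ∑ k ∈ Finset.range K, D k
      + c * ∑ k ∈ Finset.range K, A k + K * e := by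
    have sum_D_succ_le := sum_range_add_le hD (show t + 1 + R ≤ K by omega)
    have sum_D_le := sum_range_add_le hD (show t + R ≤ K by omega)
    have sum_A_le := mul_le_mul_of_nonneg_left (sum_range_add_le hA (show t + R ≤ K by omega)) hc
    have sum_e_le : R * e ≤ K * e := by gcongr; omega
    calc ∑ q ∈ Finset.range R, X (t + q)
        ≤ ∑ q ∈ Finset.range R, (2 * D (t + 1 + q) + 2 * D (t + q) + c * A (t + q) + e) :=
          Finset.sum_le_sum fun q _ => add_right_comm t 1 q ▸ hX_le (t + q)
      _ ≤ _ := by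
          simp only [Finset.sum_add_distrib, ← Finset.mul_sum, Finset.sum_const, Finset.card_range,
            nsmul_eq_mul]
          linarith
  have sum_b_le : (R + 1 : ℕ) * b ≤ K * b := by gcongr; omega
  have absorbed := mul_le_mul_of_nonneg_right hsmall
    (Finset.sum_nonneg fun q (_ : q ∈ Finset.range R) => hX (t + q))
  linarith

lemma le_sum_of_descent {f G : ℕ → ℝ} {g s : ℝ}
    (hf : ∀ k, f (k + 1) ≤ f k - g * G k - a * A k + c * D k + s) (K : ℕ) :
    f K ≤ f 0 - g * ∑ k ∈ Finset.range K, G k - a * ∑ k ∈ Finset.range K, A k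
      + c * ∑ k ∈ Finset.range K, D k + K * s := by
  induction K with
  | zero => simp
  | succ K ih =>
    simp only [Finset.sum_range_succ]
    push_cast
    linarith [hf K]

lemma consensus_feedback_le {n L α σ τ S K : ℝ} (hn : 1 ≤ n) (hα : 0 ≤ α) (hL : 0 ≤ L)
    (hαL : L * α ≤ 1 / 2) (hτ : 1 ≤ τ) (hS : 0 ≤ S) (hK : 0 ≤ K) :
    α * L ^ 2 / (2 * n) * (n * α ^ 2 / 2 * S
      + K * (α ^ 2 * σ ^ 2 / 2 + 3 * (32 * α ^ 2 * τ ^ 3 * n * σ ^ 2)))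
      ≤ α / 16 * S + K * (49 * (α ^ 3 * L ^ 2 * σ ^ 2 * τ ^ 3)) := by
  have sq_le : (L * α) ^ 2 ≤ (1 / 2) ^ 2 := by gcongr
  have inv_le : 1 / (4 * n) ≤ τ ^ 3 :=
    (div_le_one_of_le₀ (by linarith) (by linarith)).trans (one_le_pow₀ hτ)
  calc _ = α / 4 * (L * α) ^ 2 * S
        + K * (α ^ 3 * L ^ 2 * σ ^ 2 * (1 / (4 * n) + 48 * τ ^ 3)) := by
        field_simp
        ring
    _ ≤ α / 4 * (1 / 2) ^ 2 * S + K * (α ^ 3 * L ^ 2 * σ ^ 2 * (τ ^ 3 + 48 * τ ^ 3)) := by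
        gcongr
    _ = _ := by ring

lemma sum_gradients_le {f G : ℕ → ℝ} {n L α σ τ m Δ : ℝ} {K : ℕ} (hn : 1 ≤ n) (hα : 0 < α)
    (hL : 0 ≤ L) (hαL : L * α ≤ 1 / 2) (hτ : 1 ≤ τ) (hA : ∀ k, 0 ≤ A k) (hG : ∀ k, 0 ≤ G k)
    (hm : ∀ k, m ≤ f k) (hΔ : f 0 - m ≤ Δ)
    (hf : ∀ k, f (k + 1) ≤ f k - α / 2 * G k - α / 4 * A k + α * L ^ 2 / (2 * n) * D k
      + L * α ^ 2 / 2 * (σ ^ 2 / n))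
    (hD : ∑ k ∈ Finset.range K, D k ≤ n * α ^ 2 / 2 * ∑ k ∈ Finset.range K, A k
      + K * (α ^ 2 * σ ^ 2 / 2 + 3 * (32 * α ^ 2 * τ ^ 3 * n * σ ^ 2))) :
    ∑ k ∈ Finset.range K, (A k + G k) ≤ 8 * (Δ / α)
      + K * (4 * (L * σ ^ 2 / n * α) + 392 * (τ ^ 3 * L ^ 2 * σ ^ 2 * α ^ 2)) := by
  have sum_A_nonneg := Finset.sum_nonneg fun k (_ : k ∈ Finset.range K) => hA k
  have sum_G_nonneg := Finset.sum_nonneg fun k (_ : k ∈ Finset.range K) => hG k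
  have telescoped := le_sum_of_descent hf K
  have feedback_le := (mul_le_mul_of_nonneg_left hD
    (show 0 ≤ α * L ^ 2 / (2 * n) by positivity)).trans
      (consensus_feedback_le hn hα.le hL hαL hτ sum_A_nonneg K.cast_nonneg)
  rw [Finset.sum_add_distrib]
  set SA := ∑ k ∈ Finset.range K, A k
  set SG := ∑ k ∈ Finset.range K, G k
  have scaled : α / 8 * (SA + SG) ≤ Δ + K * (L * α ^ 2 / 2 * (σ ^ 2 / n))
      + K * (49 * (α ^ 3 * L ^ 2 * σ ^ 2 * τ ^ 3)) := by
    have := mul_nonneg hα.le sum_A_nonneg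
    have := mul_nonneg hα.le sum_G_nonneg
    linarith [hm K]
  calc SA + SG = α / 8 * (SA + SG) * (8 / α) := by field_simp
    _ ≤ (Δ + K * (L * α ^ 2 / 2 * (σ ^ 2 / n))
        + K * (49 * (α ^ 3 * L ^ 2 * σ ^ 2 * τ ^ 3))) * (8 / α) := by gcongr
    _ = _ := by field_simp; ring

end Recursion

/-! ### The step size -/

section StepSize

lemma inv_min_le_add {a b : ℝ} (ha : 0 < a) (hb : 0 < b) : (min a b)⁻¹ ≤ a⁻¹ + b⁻¹ := by
  rcases min_choice a b with h | h <;> rw [h]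
  · exact le_add_of_nonneg_right (inv_pos.2 hb).le
  · exact le_add_of_nonneg_left (inv_pos.2 ha).le

lemma rpow_div_three_pow_three {a : ℝ} (ha : 0 ≤ a) (s : ℝ) : (a ^ (s / 3)) ^ 3 = a ^ s := by
  rw [← Real.rpow_mul_natCast ha]
  norm_num

lemma mul_rpow_half_one_div {c T : ℝ} (hc : 0 < c) (hT : 0 < T) :
    c * (1 / (c * T)) ^ (1 / 2 : ℝ) = (c / T) ^ (1 / 2 : ℝ) := by
  rw [← Real.sqrt_eq_rpow, ← Real.sqrt_eq_rpow, eq_comm,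
    Real.sqrt_eq_iff_mul_self_eq (by positivity) (by positivity), mul_mul_mul_comm,
    Real.mul_self_sqrt (by positivity)]
  field_simp

lemma inv_rpow_half_one_div_div {c T : ℝ} (hc : 0 < c) (hT : 0 < T) :
    ((1 / (c * T)) ^ (1 / 2 : ℝ))⁻¹ / T = (c / T) ^ (1 / 2 : ℝ) := by
  rw [← Real.sqrt_eq_rpow, ← Real.sqrt_eq_rpow, eq_comm,
    Real.sqrt_eq_iff_mul_self_eq (by positivity) (by positivity), div_mul_div_comm, ← mul_inv,
    Real.mul_self_sqrt (by positivity)]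
  field_simp

lemma mul_rpow_third_one_div_sq {w τ T : ℝ} (hw : 0 < w) (hτ : 0 < τ) (hT : 0 < T) :
    τ ^ 3 * w ^ 2 * ((1 / (τ ^ 3 * w ^ 2 * T)) ^ (1 / 3 : ℝ)) ^ 2
      = τ * (w / T) ^ (2 / 3 : ℝ) := by
  refine (pow_left_inj₀ (n := 3) (by positivity) (by positivity) three_ne_zero).1 ?_
  rw [mul_pow, pow_right_comm, rpow_div_three_pow_three (by positivity), mul_pow τ,
    rpow_div_three_pow_three (by positivity), Real.rpow_one, Real.rpow_two]
  field_simp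

lemma inv_rpow_third_one_div_div {w τ T : ℝ} (hw : 0 < w) (hτ : 0 < τ) (hT : 0 < T) :
    ((1 / (τ ^ 3 * w ^ 2 * T)) ^ (1 / 3 : ℝ))⁻¹ / T = τ * (w / T) ^ (2 / 3 : ℝ) := by
  refine (pow_left_inj₀ (n := 3) (by positivity) (by positivity) three_ne_zero).1 ?_
  rw [div_pow, inv_pow, rpow_div_three_pow_three (by positivity), mul_pow τ,
    rpow_div_three_pow_three (by positivity), Real.rpow_one, Real.rpow_two]
  field_simp

variable {n τ T : ℕ} {L σ : ℝ}

lemma mul_stepSize_le (hL : 0 < L) : L * stepSize n τ T L σ ≤ 1 / 2 := by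
  calc L * stepSize n τ T L σ ≤ L * (1 / (2 * L)) :=
        mul_le_mul_of_nonneg_left ((min_le_right _ _).trans (min_le_left _ _)) hL.le
    _ = 1 / 2 := by field_simp

variable (hn : 1 ≤ n) (hτ : 1 ≤ τ) (hT : 1 ≤ T) (hL : 0 < L) (hσ : 0 < σ)

include hn hT hL hσ

lemma mul_stepSize_le_rpow :
    L * σ ^ 2 / n * stepSize n τ T L σ ≤ (L * σ ^ 2 / (n * T)) ^ (1 / 2 : ℝ) := by
  have : (0 : ℝ) < n := by positivity
  have hT' : (0 : ℝ) < T := by positivity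
  rw [← div_div, ← mul_rpow_half_one_div (by positivity) hT']
  gcongr
  exact (min_le_left _ _).trans (min_le_left _ _)

include hτ

lemma stepSize_pos : 0 < stepSize n τ T L σ := by
  have : (0 : ℝ) < n := by positivity
  have : (0 : ℝ) < τ := by positivity
  have : (0 : ℝ) < T := by positivity
  unfold stepSize
  positivity

lemma stepSize_sq_mul_le : stepSize n τ T L σ ^ 2 * L ^ 2 * (τ : ℝ) ^ 4 ≤ 1 / 48 := by
  have : (0 : ℝ) < τ := by positivity
  calc stepSize n τ T L σ ^ 2 * L ^ 2 * (τ : ℝ) ^ 4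
      ≤ (1 / (4 * Real.sqrt 3 * (τ : ℝ) ^ 2 * L)) ^ 2 * L ^ 2 * (τ : ℝ) ^ 4 := by
        gcongr
        · exact (stepSize_pos hn hτ hT hL hσ).le
        · exact (min_le_right _ _).trans (min_le_right _ _)
    _ = 1 / (16 * Real.sqrt 3 ^ 2) := by field_simp; norm_num
    _ = 1 / 48 := by rw [Real.sq_sqrt zero_le_three]; norm_num

lemma mul_stepSize_sq_le_rpow :
    (τ : ℝ) ^ 3 * L ^ 2 * σ ^ 2 * stepSize n τ T L σ ^ 2 ≤ τ * (L * σ / T) ^ (2 / 3 : ℝ) := by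
  have hτ' : (0 : ℝ) < τ := by positivity
  have hT' : (0 : ℝ) < T := by positivity
  rw [← mul_rpow_third_one_div_sq (by positivity) hτ' hT', mul_pow, ← mul_assoc]
  gcongr
  · exact (stepSize_pos hn hτ hT hL hσ).le
  · exact (min_le_left _ _).trans (min_le_right _ _)

lemma inv_stepSize_div_le :
    (stepSize n τ T L σ)⁻¹ / T ≤ 9 * ((τ : ℝ) ^ 2 * L / T) + τ * (L * σ / T) ^ (2 / 3 : ℝ)
      + (L * σ ^ 2 / (n * T)) ^ (1 / 2 : ℝ) := by
  have : (0 : ℝ) < n := by positivity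
  have hτ' : (0 : ℝ) < τ := by positivity
  have hT' : (0 : ℝ) < T := by positivity
  have smoothness_terms_le : (1 / (2 * L))⁻¹ + (1 / (4 * Real.sqrt 3 * (τ : ℝ) ^ 2 * L))⁻¹
      ≤ 9 * ((τ : ℝ) ^ 2 * L) := by
    have sqrt_three_le : Real.sqrt 3 ≤ 7 / 4 := Real.sqrt_le_iff.2 ⟨by norm_num, by norm_num⟩
    have sq_ge_one : (1 : ℝ) ≤ (τ : ℝ) ^ 2 := one_le_pow₀ (Nat.one_le_cast.2 hτ)
    calc _ = 2 * (1 * L) + 4 * (Real.sqrt 3 * ((τ : ℝ) ^ 2 * L)) := by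
          rw [one_div, inv_inv, one_div, inv_inv]; ring
      _ ≤ 2 * ((τ : ℝ) ^ 2 * L) + 4 * (7 / 4 * ((τ : ℝ) ^ 2 * L)) := by gcongr
      _ = _ := by ring
  rw [← div_div, ← inv_rpow_half_one_div_div (by positivity) hT',
    ← inv_rpow_third_one_div_div (by positivity) hτ' hT', mul_pow, ← mul_assoc, ← mul_div_assoc,
    ← add_div, ← add_div]
  gcongr
  refine (inv_min_le_add (lt_min ?_ ?_) (lt_min ?_ ?_)).trans ?_
  any_goals positivity
  refine (add_le_add (inv_min_le_add ?_ ?_) (inv_min_le_add ?_ ?_)).trans ?_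
  any_goals positivity
  linarith

variable {Δ : ℝ} (hΔ : 0 ≤ Δ)

include hΔ

lemma optimization_error_stepSize_le :
    (T + 1 : ℝ)⁻¹ * (8 * (Δ / stepSize n τ T L σ)) ≤ 8 * Δ * (9 * ((τ : ℝ) ^ 2 * L / T)
      + τ * (L * σ / T) ^ (2 / 3 : ℝ) + (L * σ ^ 2 / (n * T)) ^ (1 / 2 : ℝ)) := by
  have hα := stepSize_pos hn hτ hT hL hσ
  have : (0 : ℝ) < T := by positivity
  calc (T + 1 : ℝ)⁻¹ * (8 * (Δ / stepSize n τ T L σ))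
      ≤ (T : ℝ)⁻¹ * (8 * (Δ / stepSize n τ T L σ)) := by gcongr; linarith
    _ = 8 * Δ * ((stepSize n τ T L σ)⁻¹ / T) := by ring
    _ ≤ _ := by gcongr; exact inv_stepSize_div_le hn hτ hT hL hσ

lemma average_bound_stepSize_le :
    (T + 1 : ℝ)⁻¹ * (8 * (Δ / stepSize n τ T L σ)
      + (T + 1 : ℕ) * (4 * (L * σ ^ 2 / n * stepSize n τ T L σ)
        + 392 * ((τ : ℝ) ^ 3 * L ^ 2 * σ ^ 2 * stepSize n τ T L σ ^ 2)))
      ≤ 72 * Δ * (τ : ℝ) ^ 2 * L / T + (8 * Δ + 392) * τ * (L * σ / T) ^ (2 / 3 : ℝ)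
        + (8 * Δ + 4) * (L * σ ^ 2 / (n * T)) ^ (1 / 2 : ℝ) := by
  have optimization_error_le := optimization_error_stepSize_le hn hτ hT hL hσ hΔ
  have noise_le := mul_stepSize_le_rpow (τ := τ) hn hT hL hσ
  have consensus_error_le := mul_stepSize_sq_le_rpow hn hτ hT hL hσ
  rw [Nat.cast_add_one, mul_add, inv_mul_cancel_left₀ (by positivity)]
  calc _ ≤ 8 * Δ * (9 * ((τ : ℝ) ^ 2 * L / T) + τ * (L * σ / T) ^ (2 / 3 : ℝ)
        + (L * σ ^ 2 / (n * T)) ^ (1 / 2 : ℝ)) + (4 * (L * σ ^ 2 / (n * T)) ^ (1 / 2 : ℝ)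
        + 392 * (τ * (L * σ / T) ^ (2 / 3 : ℝ))) := by gcongr
    _ = _ := by ring

end StepSize

/-! ### The run of GT-FT -/

section Expectations

variable {n d : ℕ} {Ω : Type*} {mΩ : MeasurableSpace Ω} {μ : Measure Ω}

lemma meanSq_eq_ofReal {X : Ω → Vec d} (hX : MemLp X 2 μ) :
    meanSq μ X = ENNReal.ofReal (∫ ω, ‖X ω‖ ^ 2 ∂μ) := by
  rw [ofReal_integral_eq_lintegral_ofReal (hX.integrable_norm_pow two_ne_zero)
    (ae_of_all _ fun _ => sq_nonneg _)]
  simp only [meanSq, ENNReal.ofReal_pow (norm_nonneg _), ofReal_norm]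

lemma sum_meanSq_add_meanSq_eq_ofReal {ι : Type*} (s : Finset ι) {X Y : ι → Ω → Vec d}
    (hX : ∀ k, MemLp (X k) 2 μ) (hY : ∀ k, MemLp (Y k) 2 μ) :
    ∑ k ∈ s, (meanSq μ (X k) + meanSq μ (Y k)) =
      ENNReal.ofReal (∑ k ∈ s, (∫ ω, ‖X k ω‖ ^ 2 ∂μ + ∫ ω, ‖Y k ω‖ ^ 2 ∂μ)) := by
  have norm_sq_nonneg (Z : Ω → Vec d) : 0 ≤ ∫ ω, ‖Z ω‖ ^ 2 ∂μ :=
    integral_nonneg fun _ => sq_nonneg _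
  rw [ENNReal.ofReal_sum_of_nonneg fun k _ => add_nonneg (norm_sq_nonneg _) (norm_sq_nonneg _)]
  simp only [ENNReal.ofReal_add (norm_sq_nonneg _) (norm_sq_nonneg _), meanSq_eq_ofReal (hX _),
    meanSq_eq_ofReal (hY _)]

lemma deviation_ae_eq_zero_of_consensusError_eq_zero {x : Ω → Fin n → Vec d} (hx : Measurable x)
    (h : consensusError μ x = 0) : ∀ᵐ ω ∂μ, deviation (x ω) = 0 := by
  simp only [funext_iff, ae_all_iff]
  intro i
  have hmeas : Measurable fun ω => x ω i - avg (x ω) :=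
    ((measurable_pi_apply i).comp hx).sub (measurable_avg.comp hx)
  have meanSq_eq_zero := Finset.sum_eq_zero_iff.1 h i (Finset.mem_univ i)
  filter_upwards [(lintegral_eq_zero_iff (hmeas.enorm.pow_const 2)).1 meanSq_eq_zero] with ω hω
  simpa [deviation] using hω

variable {Ξ : Fin n → Type*} [∀ i, MeasurableSpace (Ξ i)] {P : ∀ i, Measure (Ξ i)}
  {F : ∀ i, Vec d → Ξ i → ℝ} {L Δ : ℝ} {y : Ω → Vec d}

lemma SmoothProblem.integrable_obj_of_lintegral_le [IsFiniteMeasure μ] (hS : SmoothProblem P F L)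
    (hy : Measurable y)
    (h : ∫⁻ ω, ENNReal.ofReal (obj P F (y ω) - optVal P F) ∂μ ≤ ENNReal.ofReal Δ) :
    Integrable (fun ω => obj P F (y ω)) μ := by
  have integrable_gap : Integrable (fun ω => obj P F (y ω) - optVal P F) μ :=
    ⟨((hS.differentiable_obj.continuous.measurable.comp hy).sub_const _).aestronglyMeasurable,
      (hasFiniteIntegral_iff_ofReal (ae_of_all _ fun _ => sub_nonneg.2 (hS.optVal_le _))).2
        (h.trans_lt ENNReal.ofReal_lt_top)⟩
  simpa [Pi.add_def] using integrable_gap.add (integrable_const (optVal P F))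

lemma SmoothProblem.integral_obj_sub_le_of_lintegral_le [IsProbabilityMeasure μ]
    (hS : SmoothProblem P F L) (hy : Integrable (fun ω => obj P F (y ω)) μ) (hΔ : 0 ≤ Δ)
    (h : ∫⁻ ω, ENNReal.ofReal (obj P F (y ω) - optVal P F) ∂μ ≤ ENNReal.ofReal Δ) :
    ∫ ω, obj P F (y ω) ∂μ - optVal P F ≤ Δ := by
  calc ∫ ω, obj P F (y ω) ∂μ - optVal P F
      = ∫ ω, (obj P F (y ω) - optVal P F) ∂μ := by
        rw [integral_sub hy (integrable_const _)]; simp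
    _ = (∫⁻ ω, ENNReal.ofReal (obj P F (y ω) - optVal P F) ∂μ).toReal :=
        integral_eq_lintegral_of_nonneg_ae (ae_of_all _ fun _ => sub_nonneg.2 (hS.optVal_le _))
          (hy.sub (integrable_const _)).aestronglyMeasurable
    _ ≤ (ENNReal.ofReal Δ).toReal := ENNReal.toReal_mono ENNReal.ofReal_ne_top h
    _ = Δ := ENNReal.toReal_ofReal hΔ

end Expectations

section Iterates

variable {n d : ℕ} {Ξ : Fin n → Type*} {F : ∀ i, Vec d → Ξ i → ℝ}
  {W V U : ℕ → Matrix (Fin n) (Fin n) ℝ} {α σ L : ℝ} {t : ℕ} {Ω : Type*}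
  {x₀ : Ω → Fin n → Vec d} {ξ : ℕ → ∀ i, Ω → Ξ i}

lemma isTracking_gradTracking (F : ∀ i, Vec d → Ξ i → ℝ) (A B : ℕ → Matrix (Fin n) (Fin n) ℝ)
    (α : ℝ) (x₀ : Fin n → Vec d) (ζ : ℕ → ∀ i, Ξ i) :
    IsTracking A B α (fun k => (gradTracking F A B α x₀ ζ k).1)
      (fun k => (gradTracking F A B α x₀ ζ k).2)
      (fun k => stochGrad F (gradTracking F A B α x₀ ζ k).1 (ζ k)) :=
  ⟨rfl, fun _ => rfl, fun _ => rfl⟩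

lemma avg_iterates_succ (hW : FiniteTimeConsensus (t + 1) W)
    (hV : ∀ k < t + 1, V k ∈ doublyStochastic ℝ (Fin n))
    (hU : ∀ k ≤ t + 1, U k ∈ doublyStochastic ℝ (Fin n)) (k : ℕ) (ω : Ω) :
    avg (iterates F (t + 1) W V U α x₀ ξ (k + 1) ω) = avg (iterates F (t + 1) W V U α x₀ ξ k ω)
      - α • avg (stochGrad F (iterates F (t + 1) W V U α x₀ ξ k ω) fun i => ξ k i ω) :=
  (isTracking_gradTracking F _ _ α (x₀ ω) fun j i => ξ j i ω).avg_x_succ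
    (mixSchedule_mem_doublyStochastic hW hV) (trackSchedule_mem_doublyStochastic hU) k

variable [∀ i, MeasurableSpace (Ξ i)] {P : ∀ i, Measure (Ξ i)} {mΩ : MeasurableSpace Ω}
  {μ : Measure Ω}

lemma trueGrad_add_noise (P : ∀ i, Measure (Ξ i)) (F : ∀ i, Vec d → Ξ i → ℝ)
    (x : ℕ → Ω → Fin n → Vec d) (ξ : ℕ → ∀ i, Ω → Ξ i) (k : ℕ) (ω : Ω) :
    (trueGrad P F (x k ω) + fun i => noise P F x ξ k i ω)
      = stochGrad F (x k ω) fun i => ξ k i ω :=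
  funext fun _ => add_sub_cancel _ _

lemma NoiseAssumption.orthogonalNoise [IsProbabilityMeasure μ]
    (hN : NoiseAssumption μ P F (iterates F (t + 1) W V U α x₀ ξ) ξ σ) (hF : LossRegular P F)
    (hS : SmoothProblem P F L) :
    OrthogonalNoise μ (fun k ω i => noise P F (iterates F (t + 1) W V U α x₀ ξ) ξ k i ω) σ where
  memLp k := .of_eval (hN.memLp k)
  orthogonal := hN.pairwise_integral_inner_eq_zero hF hS
  variance := hN.integral_norm_sq_le fun _ =>
    hF.measurable_iterates hN.measurable_init fun l _ => hN.measurable_sample l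

lemma trackedRun_iterates [IsProbabilityMeasure μ] (hF : LossRegular P F)
    (hS : SmoothProblem P F L) (hα : α ≠ 0) (hW : FiniteTimeConsensus (t + 1) W)
    (hV : ∀ k < t + 1, V k ∈ doublyStochastic ℝ (Fin n))
    (hU : ∀ k ≤ t + 1, U k ∈ doublyStochastic ℝ (Fin n))
    (hN : NoiseAssumption μ P F (iterates F (t + 1) W V U α x₀ ξ) ξ σ)
    (hinit : Integrable
      (fun ω => obj P F (avg (iterates F (t + 1) W V U α x₀ ξ 0 ω))) μ)
    (hconsensus : ∑ k ∈ Finset.range (t + 1 + 1),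
      consensusError μ (iterates F (t + 1) W V U α x₀ ξ k) = 0) :
    TrackedRun μ P F (iterates F (t + 1) W V U α x₀ ξ)
      (fun k ω i => noise P F (iterates F (t + 1) W V U α x₀ ξ) ξ k i ω) α σ t := by
  have measurable_iterates (k : ℕ) : Measurable (iterates F (t + 1) W V U α x₀ ξ k) :=
    hF.measurable_iterates hN.measurable_init fun l _ => hN.measurable_sample l
  have consensual (k : ℕ) (hk : k ≤ t + 1) :
      ∀ᵐ ω ∂μ, deviation (iterates F (t + 1) W V U α x₀ ξ k ω) = 0 :=
    deviation_ae_eq_zero_of_consensusError_eq_zero (measurable_iterates k)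
      (Finset.sum_eq_zero_iff.1 hconsensus k (Finset.mem_range_succ_iff.2 hk))
  refine ⟨measurable_iterates, hinit, hN.orthogonalNoise hF hS, fun k i ψ hψ hψ2 => ?_,
    fun k ω => ?_, consensual, fun p => ?_⟩
  · exact hN.integral_inner_eq_zero hF hS (q := (k, i))
      (hψ.comp (measurable_otherSamples_iterates hF le_rfl)) hψ2
  · rw [← isLinearMap_avg.map_add, trueGrad_add_noise, avg_iterates_succ hW hV hU]
  · refine ⟨_, fun q => mul_mem (hW.sweep_mod_mem q (p - q))
      (trackSchedule_mem_doublyStochastic hU (t + 1 + q)), ?_⟩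
    filter_upwards [consensual t t.le_succ, consensual (t + 1) le_rfl] with ω hω hω'
    simp only [trueGrad_add_noise]
    exact (isTracking_gradTracking F _ _ α (x₀ ω) fun j i => ξ j i ω).deviation_eq_sum_lag
      hW hV hU hα hω hω' p

end Iterates

namespace TrackedRun

variable {n d : ℕ} {Ξ : Fin n → Type*} [∀ i, MeasurableSpace (Ξ i)]
  {P : ∀ i, Measure (Ξ i)} {F : ∀ i, Vec d → Ξ i → ℝ} {Ω : Type*} {mΩ : MeasurableSpace Ω}
  {μ : Measure Ω} {x N : ℕ → Ω → Fin n → Vec d} {L α σ Δ : ℝ} {t T : ℕ}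

lemma sum_integral_sqNorm_deviation_le [IsFiniteMeasure μ] (h : TrackedRun μ P F x N α σ t)
    (hS : SmoothProblem P F L) (hατ : α ^ 2 * L ^ 2 * ((t + 1 : ℕ) : ℝ) ^ 4 ≤ 1 / 48)
    (hT : t + 1 ≤ T) :
    ∑ k ∈ Finset.range (T + 1), ∫ ω, sqNorm (deviation (x k ω)) ∂μ ≤
      n * α ^ 2 / 2 * ∑ k ∈ Finset.range (T + 1), ∫ ω, ‖avg (trueGrad P F (x k ω))‖ ^ 2 ∂μ
        + (T + 1 : ℕ) * (α ^ 2 * σ ^ 2 / 2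
          + 3 * (32 * α ^ 2 * ((t + 1 : ℕ) : ℝ) ^ 3 * n * σ ^ 2)) := by
  obtain ⟨R, rfl⟩ := Nat.exists_eq_add_of_le hT
  refine sum_le_of_coupled_recursion (a := 4 * α ^ 2 * ((t + 1 : ℕ) : ℝ) ^ 2 * L ^ 2)
    (fun k => integral_nonneg fun ω => sq_nonneg ‖avg (trueGrad P F (x k ω))‖)
    (fun k => integral_nonneg fun ω => sqNorm_nonneg (deviation (x k ω)))
    (fun k => integral_nonneg fun ω => sqNorm_nonneg (x (k + 1) ω - x k ω))
    (by positivity) (by positivity) (by positivity) (by positivity)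
    (fun k hk => h.integral_sqNorm_deviation_eq_zero hk.le)
    (fun p => (h.integral_sqNorm_deviation_le hS p).trans_eq (by ring))
    (h.integral_sqNorm_sub_le hS) ?_ R
  linarith

lemma sum_integral_gradients_le [IsProbabilityMeasure μ] (h : TrackedRun μ P F x N α σ t)
    (hS : SmoothProblem P F L) (hn : 1 ≤ n) (hα : 0 < α) (hαL : L * α ≤ 1 / 2)
    (hατ : α ^ 2 * L ^ 2 * ((t + 1 : ℕ) : ℝ) ^ 4 ≤ 1 / 48)
    (hΔ : ∫ ω, obj P F (avg (x 0 ω)) ∂μ - optVal P F ≤ Δ) (hT : t + 1 ≤ T) :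
    ∑ k ∈ Finset.range (T + 1), (∫ ω, ‖avg (trueGrad P F (x k ω))‖ ^ 2 ∂μ
        + ∫ ω, ‖gradient (obj P F) (avg (x k ω))‖ ^ 2 ∂μ)
      ≤ 8 * (Δ / α) + (T + 1 : ℕ) * (4 * (L * σ ^ 2 / n * α)
        + 392 * (((t + 1 : ℕ) : ℝ) ^ 3 * L ^ 2 * σ ^ 2 * α ^ 2)) := by
  have optVal_le (k : ℕ) : optVal P F ≤ ∫ ω, obj P F (avg (x k ω)) ∂μ := by
    simpa using integral_mono (integrable_const (optVal P F)) (h.integrable_obj hS k)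
      fun ω => hS.optVal_le _
  exact sum_gradients_le (Nat.one_le_cast.2 hn) hα hS.pos.le hαL
    (Nat.one_le_cast.2 (Nat.le_add_left 1 t)) (fun k => integral_nonneg fun ω => sq_nonneg _)
    (fun k => integral_nonneg fun ω => sq_nonneg _) optVal_le hΔ
    (h.integral_obj_avg_succ_le hS hα.le hαL) (h.sum_integral_sqNorm_deviation_le hS hατ hT)

lemma average_meanSq_le [IsProbabilityMeasure μ]
    (h : TrackedRun μ P F x N (stepSize n (t + 1) T L σ) σ t) (hS : SmoothProblem P F L)
    (hn : 1 ≤ n) (hσ : 0 < σ) (hΔ₀ : 0 ≤ Δ)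
    (hΔ : ∫ ω, obj P F (avg (x 0 ω)) ∂μ - optVal P F ≤ Δ) (hT : t + 1 ≤ T) :
    ((T : ℝ≥0∞) + 1)⁻¹ * ∑ k ∈ Finset.range (T + 1),
        (meanSq μ (fun ω => avg (trueGrad P F (x k ω)))
          + meanSq μ (fun ω => gradient (obj P F) (avg (x k ω))))
      ≤ ENNReal.ofReal (72 * Δ * ((t + 1 : ℕ) : ℝ) ^ 2 * L / T
          + (8 * Δ + 392) * ((t + 1 : ℕ) : ℝ) * (L * σ / T) ^ (2 / 3 : ℝ)
          + (8 * Δ + 4) * (L * σ ^ 2 / (n * T)) ^ (1 / 2 : ℝ)) := by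
  have hτ : 1 ≤ t + 1 := Nat.le_add_left 1 t
  have hT1 : 1 ≤ T := hτ.trans hT
  have sum_le := h.sum_integral_gradients_le hS hn (stepSize_pos hn hτ hT1 hS.pos hσ)
    (mul_stepSize_le hS.pos) (stepSize_sq_mul_le hn hτ hT1 hS.pos hσ) hΔ hT
  have inv_eq : ((T : ℝ≥0∞) + 1)⁻¹ = ENNReal.ofReal ((T + 1 : ℝ)⁻¹) := by
    rw [ENNReal.ofReal_inv_of_pos (by positivity), ENNReal.ofReal_add (by positivity) zero_le_one,
      ENNReal.ofReal_natCast, ENNReal.ofReal_one]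
  rw [sum_meanSq_add_meanSq_eq_ofReal _ (h.memLp_avg_trueGrad hS) (h.memLp_gradient hS), inv_eq,
    ← ENNReal.ofReal_mul (by positivity)]
  exact ENNReal.ofReal_le_ofReal ((mul_le_mul_of_nonneg_left sum_le (by positivity)).trans
    (average_bound_stepSize_le hn hτ hT1 hS.pos hσ hΔ₀))

end TrackedRun

end GTFT

theorem mainTheorem2 (Δ : ℝ) :
    ∃ γ₇ γ₈ γ₉ : ℝ, 0 < γ₇ ∧ 0 < γ₈ ∧ 0 < γ₉ ∧
      ∀ (n d τ T : ℕ) (L σ : ℝ)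
        (Ξ : Fin n → Type*) [∀ i, MeasurableSpace (Ξ i)]
        (P : ∀ i, Measure (Ξ i)) [∀ i, IsProbabilityMeasure (P i)]
        (F : ∀ i, GTFT.Vec d → Ξ i → ℝ)
        (Ω : Type*) [MeasurableSpace Ω] (μ : Measure Ω) [IsProbabilityMeasure μ]
        (W V U : ℕ → Matrix (Fin n) (Fin n) ℝ)
        (x₀ : Ω → Fin n → GTFT.Vec d) (ξ : ℕ → ∀ i, Ω → Ξ i)
        (x : ℕ → Ω → Fin n → GTFT.Vec d),
        1 ≤ n → τ ≤ T →
        GTFT.LossRegular P F →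
        GTFT.SmoothProblem P F L →
        GTFT.FiniteTimeConsensus τ W →
        (∀ k < τ, V k ∈ doublyStochastic ℝ (Fin n)) →
        (∀ k ≤ τ, U k ∈ doublyStochastic ℝ (Fin n)) →
        x = GTFT.iterates F τ W V U (GTFT.stepSize n τ T L σ) x₀ ξ →
        GTFT.NoiseAssumption μ P F x ξ σ →
        (∫⁻ ω, ENNReal.ofReal (GTFT.obj P F (GTFT.avg (x 0 ω)) - GTFT.optVal P F) ∂μ
          ≤ ENNReal.ofReal Δ) →
        (∑ k ∈ Finset.range (τ + 1), GTFT.consensusError μ (x k) = 0) →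
        ((T : ℝ≥0∞) + 1)⁻¹ * ∑ k ∈ Finset.range (T + 1),
            (GTFT.meanSq μ (fun ω => GTFT.avg (GTFT.trueGrad P F (x k ω)))
              + GTFT.meanSq μ (fun ω => gradient (GTFT.obj P F) (GTFT.avg (x k ω))))
          ≤ ENNReal.ofReal
              (γ₇ * (τ : ℝ) ^ 2 * L / T
                + γ₈ * τ * (L * σ / T) ^ (2 / 3 : ℝ)
                + γ₉ * (L * σ ^ 2 / (n * T)) ^ (1 / 2 : ℝ)) := by
  refine ⟨72 * max Δ 1, 8 * max Δ 1 + 392, 8 * max Δ 1 + 4, by positivity, by positivity,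
    by positivity, ?_⟩
  intro n d τ T L σ Ξ _ P _ F Ω _ μ _ W V U x₀ ξ x hn hT hF hS hW hV hU hx hN hΔ hconsensus
  obtain ⟨t, rfl⟩ := Nat.exists_eq_add_of_le' hW.one_le
  subst hx
  have hα := GTFT.stepSize_pos hn hW.one_le (hW.one_le.trans hT) hS.pos hN.pos
  have hΔ₀ : 0 ≤ max Δ 1 := by positivity
  have hΔ' := hΔ.trans (ENNReal.ofReal_le_ofReal (le_max_left Δ 1))
  have integrable_init := hS.integrable_obj_of_lintegral_le
    (GTFT.measurable_avg.comp hN.measurable_init) hΔ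
  have hrun := GTFT.trackedRun_iterates hF hS hα.ne' hW hV hU hN integrable_init hconsensus
  exact hrun.average_meanSq_le hS hn hN.pos hΔ₀
    (hS.integral_obj_sub_le_of_lintegral_le integrable_init hΔ₀ hΔ') hT
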